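/- **Set-up.** Let $n\ge 1$, let $\Lambda\subseteq\mathbb R^n$ be a lattice of full rank, and let $\Phi$ be an endomorphism of $\mathbb R^n$ with $\Phi(\Lambda)\subseteq\Lambda$ all of whose (complex) eigenvalues have the same absolute value $\rho>1$, where $\rho^n\in\mathbb N$. Let $\|\cdot\|$ be a norm on $\mathbb R^n$ whose induced operator norm satisfies $\|\Phi\|=\rho$ and $\|\Phi^{-1}\|=\rho^{-1}$. Let $\lambda$ be Lebesgue measure. Let $T\subseteq\mathbb R^n$ be closed with $\lambda(\partial T)=0$, $\bigcup_{z\in\Lambda}(z+T)=\mathbb R^n$, and $T\cap(z+T)\subseteq\partial T$ for $0\ne z\in\Lambda$; put $d_\Lambda=\lambda(T)$. Let $r,R>0$ be such that $T$ contains the closed ball of radius $r$ around $0$ and is contained in the closed ball of radius $R$ around $0$, and let $w\ge 1$ be an integer with $R/r<\rho^w-1$. Let $\mathcal D\subseteq\Lambda\cap\Phi^wT$ consist of $0$ and exactly one representative of each residue class of $\Lambda$ modulo $\Phi^w\Lambda$ that is not contained in $\Phi\Lambda$, with $|\mathcal D|=\rho^{n(w-1)}(\rho^n-1)+1$. Let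 $\widetilde T\subseteq T$ be such that $\mathbb R^n$ is the disjoint union of the sets $z+\widetilde T$, $z\in\Lambda$, and for $x=u+v$ with $u\in\Lambda$, $v\in\widetilde T$ put $\{x\}_\Lambda=v$. A *$w$-NAF* is a sequence $\xi\in\mathcal D^{\mathbb Z}$ such that any $w$ consecutive digits contain at most one non-zero digit; its value is $\sum_{j\in\mathbb Z}\Phi^j\xi_j$ (for $\xi$ with $\xi_j=0$ for all large $j$). Let $\mathcal F$ be the set of values of the $w$-NAFs with $\xi_j=0$ for all $j\ge 0$. For $0\ne\eta\in\mathcal D$ let $\mathcal W_\eta$ be the set of values of the $w$-NAFs with $\xi_j=0$ for all $j\ge0$ and $\xi_{-w}=\eta$, and for $j\in\mathbb N_0$ let $\mathcal W_{\eta,j}$ be the set of values of those that in addition satisfy $\xi_i=0$ for all $i<-(j+w)$. For $B\subseteq\mathbb R^n$ and $k\in\mathbb Z$ let $[B]_k=\Phi^{-k}\bigl(\bigcup_{z\in\Phi^kB\cap\Lambda}(z+T)\bigr)$ (cell covering), and put $A_{\eta,j}=[\mathcal W_{\eta,j}]_{j+w}$, $W_{\eta,j}=\{A_{\eta,j}\}_\Lambda$,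 $W_\eta=\{\mathcal W_\eta\}_\Lambda$, $\beta_{\eta,j}=\lambda(A_{\eta,j})-\lambda(\mathcal W_\eta)$, $$E=\frac1{\rho^{n(w-1)}((\rho^n-1)w+1)},\qquad \mu=\Bigl(1+\frac1{\rho^nw^3}\Bigr)^{-1}<1.$$ **Proposition (Properties of the Characteristic Sets).** For every $0\neq\eta\in\mathcal D$ the following hold. (a) $\mathcal W_\eta=\Phi^{-w}\eta+\Phi^{-2w+1}\mathcal F$. (b) $\mathcal W_\eta$ is compact. (c) $\mathcal W_\eta=\overline{\bigcup_{j\in\mathbb N_0}\mathcal W_{\eta,j}}=\overline{\lim_{j\to\infty}\mathcal W_{\eta,j}}$, where the set limit exists (limes inferior and limes superior coincide). (d) $\mathcal W_\eta=\overline{\liminf_{j}A_{\eta,j}}=\overline{\limsup_{j}A_{\eta,j}}$. (e) $\operatorname{int}\mathcal W_\eta\subseteq\liminf_{j}A_{\eta,j}$. (f) $\mathcal W_\eta-\Phi^{-w}\eta\subseteq T$, and $A_{\eta,j}-\Phi^{-w}\eta\subseteq T$ for all $j\in\mathbb N_0$. (g) $W_\eta$ and all $W_{\eta,j}$ are Lebesgue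 measurable, $\lambda(\mathcal W_\eta)=\lambda(W_\eta)$, and $\lambda(A_{\eta,j})=\lambda(W_{\eta,j})$ for all $j\in\mathbb N_0$. (h) $\lambda(A_{\eta,j})=d_\Lambda E+O(\mu^j)$ for $j\in\mathbb N_0$. (i) $\lambda(W_\eta)=d_\Lambda E$. (j) $\beta_{\eta,j}=\int_T(\mathbf 1_{W_{\eta,j}}-\mathbf 1_{W_\eta})(x)\,dx=O(\mu^j)$ for $j\in\mathbb N_0$. The constants in the $O$-terms do not depend on $j$. -/

import Mathlib

open Filter Topology MeasureTheory Set
open scoped ENNReal Pointwise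

noncomputable section

namespace WNAF

variable {E : Type*} [NormedAddCommGroup E] [NormedSpace ℝ E]

/-- `D` is a reduced residue digit set modulo `Φ ^ w`: it consists of `0` and of exactly one
representative of each residue class of `Λ` modulo `Φ ^ w Λ` that is not contained in `Φ Λ`.
(For `w ≥ 1` and `Φ Λ ⊆ Λ`, the class of `z` is contained in `Φ Λ` exactly if `z ∈ Φ Λ`.) -/
structure IsReducedResidueDigitSet (Λ : Submodule ℤ E) (Φ : E ≃L[ℝ] E) (w : ℕ) (D : Set E) :
    Prop where
  subset : D ⊆ Λ
  zero_mem : (0 : E) ∈ D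
  notMem_image : ∀ d ∈ D, d ≠ 0 → d ∉ Φ '' (Λ : Set E)
  existsUnique : ∀ z ∈ Λ, z ∉ Φ '' (Λ : Set E) → ∃! d, d ∈ D ∧ z - d ∈ (Φ ^ w) '' (Λ : Set E)

/-- A bi-infinite sequence of digits is a width-`w` non-adjacent form if each block
`ξ (j + w - 1), …, ξ j` contains at most one non-zero digit. -/
structure IsWNAF (D : Set E) (w : ℕ) (ξ : ℤ → E) : Prop where
  mem : ∀ j, ξ j ∈ D
  block : ∀ j : ℤ, {i | i ∈ Set.Ico j (j + w) ∧ ξ i ≠ 0}.Subsingleton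

/-- The left-length `sup ({0} ∪ {j + 1 | ξ j ≠ 0})`. -/
def leftLength (ξ : ℤ → E) : ℕ∞ := ⨆ j ∈ {j : ℤ | ξ j ≠ 0}, ((j + 1).toNat : ℕ∞)

/-- The right-length `- inf ({0} ∪ {j | ξ j ≠ 0})`. -/
def rightLength (ξ : ℤ → E) : ℕ∞ := ⨆ j ∈ {j : ℤ | ξ j ≠ 0}, ((-j).toNat : ℕ∞)

/-- The set of all width-`w` non-adjacent forms of left-length at most `l` and right-length at
most `r`. -/
def wnafSet (D : Set E) (w : ℕ) (l r : ℕ∞) : Set (ℤ → E) :=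
  {ξ | IsWNAF D w ξ ∧ leftLength ξ ≤ l ∧ rightLength ξ ≤ r}

/-- The value `∑ Φ ^ j (ξ j)`, summed over all integers `j`. -/
def value (Φ : E ≃L[ℝ] E) (ξ : ℤ → E) : E := ∑' j : ℤ, (Φ ^ j) (ξ j)

/-- The fundamental domain: all values of non-adjacent forms of left-length `0`. -/
def fundDomain (Φ : E ≃L[ℝ] E) (D : Set E) (w : ℕ) : Set E := value Φ '' wnafSet D w 0 ⊤

/-- The tiling property of `T` with respect to the lattice `Λ`, for closed `T` with boundary of
measure zero. -/
structure IsTiling [MeasurableSpace E] (vol : Measure E) (Λ : Submodule ℤ E) (T : Set E) :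
    Prop where
  iUnion_eq : ⋃ z ∈ Λ, (z +ᵥ T) = univ
  inter_subset : ∀ z ∈ Λ, z ≠ 0 → T ∩ (z +ᵥ T) ⊆ frontier T
  isClosed : IsClosed T
  frontier_null : vol (frontier T) = 0

/-- The space is the disjoint union of the translates `z + T'`, `z ∈ Λ`, that is, each point has
exactly one decomposition `x = u + v` with `u ∈ Λ` and `v ∈ T'`. -/
def IsExactTiling (Λ : Submodule ℤ E) (T' : Set E) : Prop :=
  ∀ x : E, ∃! v : E, v ∈ T' ∧ x - v ∈ Λ

/-- The fractional part: the `v` in `x = u + v` with `u ∈ Λ` and `v ∈ T'`. -/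
def fracPart {Λ : Submodule ℤ E} {T' : Set E} (h : IsExactTiling Λ T') (x : E) : E :=
  (h x).choose

/-- The cell covering of the lattice points inside `B`. -/
def cellCover (Λ : Submodule ℤ E) (T B : Set E) : Set E := ⋃ z ∈ B ∩ (Λ : Set E), (z +ᵥ T)

/-- The scaled cell covering `Φ ^ (-j) (cellCover (Φ ^ j B))`. -/
def cellCoverAt (Λ : Submodule ℤ E) (T : Set E) (Φ : E ≃L[ℝ] E) (j : ℤ) (B : Set E) : Set E :=
  (Φ ^ (-j)) '' cellCover Λ T ((Φ ^ j) '' B)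

/-- The characteristic set of the digit `η`. -/
def charSet (Φ : E ≃L[ℝ] E) (D : Set E) (w : ℕ) (η : E) : Set E :=
  value Φ '' {ξ | ξ ∈ wnafSet D w 0 ⊤ ∧ ξ (-(w : ℤ)) = η}

/-- The finite-level set of the digit `η`. -/
def charSetLevel (Φ : E ≃L[ℝ] E) (D : Set E) (w : ℕ) (η : E) (j : ℕ) : Set E :=
  value Φ '' {ξ | ξ ∈ wnafSet D w 0 ((j + w : ℕ) : ℕ∞) ∧ ξ (-(w : ℤ)) = η}

/-- The `j`th approximation of the characteristic set of the digit `η`. -/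
def charApprox (Λ : Submodule ℤ E) (T : Set E) (Φ : E ≃L[ℝ] E) (D : Set E) (w : ℕ) (η : E)
    (j : ℕ) : Set E :=
  cellCoverAt Λ T Φ ((j : ℤ) + w) (charSetLevel Φ D w η j)

/-- The difference between the measures of the `j`th approximation and of the characteristic
set. -/
def beta [MeasurableSpace E] (vol : Measure E) (Λ : Submodule ℤ E) (T : Set E) (Φ : E ≃L[ℝ] E)
    (D : Set E) (w : ℕ) (η : E) (j : ℕ) : ℝ :=
  vol.real (charApprox Λ T Φ D w η j) - vol.real (charSet Φ D w η)

/-- The constant `1 / (ρ ^ (n (w - 1)) ((ρ ^ n - 1) w + 1))`. -/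
def expectConst (ρ : ℝ) (n w : ℕ) : ℝ := 1 / (ρ ^ (n * (w - 1)) * ((ρ ^ n - 1) * w + 1))

/-- The constant `(1 + 1 / (ρ ^ n w ^ 3))⁻¹`. -/
def decayConst (ρ : ℝ) (n w : ℕ) : ℝ := (1 + 1 / (ρ ^ n * (w : ℝ) ^ 3))⁻¹

end WNAF

end

noncomputable section

set_option linter.unusedSectionVars false

/-! ### Values of non-adjacent forms with prescribed support: splitting, shifting, compactness. -/

namespace WNAF

variable {E : Type*} [NormedAddCommGroup E] [NormedSpace ℝ E]
variable {Φ : E ≃L[ℝ] E} {ρ : ℝ} {D : Set E} {w : ℕ}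

/-! ### Integer powers of a similarity -/

/-! The two operator norms force Φ to be a similarity of ratio ρ (`norm_map_eq`), and the
eigenvalues give it the volume factor q = ρ^n (`abs_det_eq_pow`). All sets involved are then
translates of sets `valueSet Φ D w I`, which Φ moves by shifting I and which decompose by fixing one
digit (`valueSet_split`).

Topology. Value sets with support bounded above are compact, as continuous images of closed sets of
sequences over a finite alphabet. A norm estimate puts both the characteristic set and its
approximations within R/(ρ^w - 1) < r of Φ^(-w) η. Hence their translates lie in T, and taking
fractional parts is injective on them and preserves measure. Each approximation contains the level
set and stays within ρ^(-(j+w)) R of the characteristic set; this gives the limit statements. The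
one about interior points also needs that lattice points with a non-adjacent expansion have a finite
one, which rests on 0 being the only lattice point among the fractional values
(`eq_zero_of_mem_valueSet_Iio`).

Counting. The j-th approximation consists of N(j+1-w) scaled tiles overlapping in null sets, where
N(m+1) = N(m) + q^(w-1) (q-1) N(m+1-w). After normalisation this recurrence has the root 1, and all
its other roots are smaller than μ in modulus (`norm_root_charPoly_lt`), whence the limit and the
error term.

Volume of the characteristic set. It is at least the limit, because the approximations lie in
shrinking neighbourhoods of a compact set (`le_measureReal_charSet`). The reverse inequality is a
packing argument for the fundamental domain F (`measureReal_fundDomain_le`). The image ΦF is the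
union of F and the sets η + Φ^(1-w) F, whose volumes add up exactly to that of ΦF; so the pieces
overlap in null sets, and so do the cells of distinct integer expansions (`aedisjoint_cell`). Every
lattice point has a finite expansion (`exists_node`), so the cells of the lattice points in a large
ball are a packing, of volume λ(F)/q^k if k zeros are still due; divisibility by Φ bounds k.
Comparing with the volume of the ball bounds λ(F), and this bound agrees with the limit from
counting. -/

lemma zpow_add_apply (Φ : E ≃L[ℝ] E) (a b : ℤ) (x : E) : (Φ ^ (a + b)) x = (Φ ^ a) ((Φ ^ b) x) := by
  rw [zpow_add]; rfl

lemma zpow_zero_apply (Φ : E ≃L[ℝ] E) (x : E) : (Φ ^ (0 : ℤ)) x = x := rfl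

lemma zpow_neg_zpow_apply (Φ : E ≃L[ℝ] E) (a : ℤ) (x : E) : (Φ ^ (-a)) ((Φ ^ a) x) = x := by
  rw [← zpow_add_apply, neg_add_cancel, zpow_zero_apply]

lemma zpow_zpow_neg_apply (Φ : E ≃L[ℝ] E) (a : ℤ) (x : E) : (Φ ^ a) ((Φ ^ (-a)) x) = x := by
  rw [← zpow_add_apply, add_neg_cancel, zpow_zero_apply]

lemma zpow_natCast_apply (Φ : E ≃L[ℝ] E) (m : ℕ) (x : E) : (Φ ^ (m : ℤ)) x = (Φ ^ m) x := by
  rw [zpow_natCast]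

lemma zpow_one_apply (Φ : E ≃L[ℝ] E) (x : E) : (Φ ^ (1 : ℤ)) x = Φ x := by
  rw [zpow_one]

lemma norm_zpow_apply (hρ : 1 < ρ) (hΦ : ∀ x, ‖Φ x‖ = ρ * ‖x‖) (k : ℤ) (x : E) :
    ‖(Φ ^ k) x‖ = ρ ^ k * ‖x‖ := by
  have hρ0 : ρ ≠ 0 := by positivity
  induction k using Int.induction_on generalizing x with
  | zero => rw [zpow_zero_apply, zpow_zero, one_mul]
  | succ i ih =>
    rw [zpow_add_apply, ih, zpow_one_apply, hΦ, zpow_add₀ hρ0, zpow_one]; ring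
  | pred i ih =>
    have h1 : ‖(Φ ^ (-(i : ℤ))) x‖ = ρ * ‖(Φ ^ (-(i : ℤ) - 1)) x‖ := by
      rw [← hΦ, ← zpow_one_apply Φ, ← zpow_add_apply]
      congr 3; ring
    rw [ih] at h1
    rw [zpow_sub₀ hρ0, zpow_one]
    field_simp
    linarith

lemma image_zpow_image (Φ : E ≃L[ℝ] E) (a b : ℤ) (s : Set E) :
    (Φ ^ a) '' ((Φ ^ b) '' s) = (Φ ^ (a + b)) '' s := by
  rw [image_image]
  exact image_congr fun x _ => (zpow_add_apply Φ a b x).symm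

lemma image_zpow_zero (Φ : E ≃L[ℝ] E) (s : Set E) : (Φ ^ (0 : ℤ)) '' s = s :=
  (image_congr fun x _ => zpow_zero_apply Φ x).trans (image_id' s)

lemma image_clm_vadd (Φ : E ≃L[ℝ] E) (x : E) (s : Set E) :
    Φ '' (x +ᵥ s) = Φ x +ᵥ Φ '' s := by
  ext y
  simp only [mem_image, mem_vadd_set, vadd_eq_add]
  constructor
  · rintro ⟨_, ⟨z, hz, rfl⟩, rfl⟩
    exact ⟨Φ z, ⟨z, hz, rfl⟩, (map_add Φ x z).symm⟩
  · rintro ⟨_, ⟨z, hz, rfl⟩, rfl⟩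
    exact ⟨x + z, ⟨z, hz, rfl⟩, map_add Φ x z⟩

/-! ### Non-adjacent forms supported in a set of positions -/

lemma isWNAF_iff {ξ : ℤ → E} :
    IsWNAF D w ξ ↔ (∀ j, ξ j ∈ D) ∧ ∀ i k : ℤ, i < k → k < i + w → ξ i = 0 ∨ ξ k = 0 := by
  constructor
  · rintro ⟨h1, h2⟩
    refine ⟨h1, fun i k hik hki => ?_⟩
    by_contra! hc
    have : i = k := h2 i ⟨⟨le_rfl, by omega⟩, hc.1⟩ ⟨⟨hik.le, hki⟩, hc.2⟩
    omega
  · rintro ⟨h1, h2⟩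
    refine ⟨h1, fun j i hi k hk => ?_⟩
    obtain ⟨⟨hi1, hi2⟩, hi0⟩ := hi
    obtain ⟨⟨hk1, hk2⟩, hk0⟩ := hk
    rcases lt_trichotomy i k with h | h | h
    · rcases h2 i k h (by omega) with h' | h' <;> contradiction
    · exact h
    · rcases h2 k i h (by omega) with h' | h' <;> contradiction

/-- The width-`w` non-adjacent forms whose non-zero digits are at positions in `I`. -/
def expansionSet (D : Set E) (w : ℕ) (I : Set ℤ) : Set (ℤ → E) :=
  {ξ | IsWNAF D w ξ ∧ ∀ i, ξ i ≠ 0 → i ∈ I}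

/-- The values of the width-`w` non-adjacent forms whose non-zero digits are at positions in
`I`. -/
def valueSet (Φ : E ≃L[ℝ] E) (D : Set E) (w : ℕ) (I : Set ℤ) : Set E :=
  value Φ '' expansionSet D w I

lemma valueSet_mono {I J : Set ℤ} (h : I ⊆ J) : valueSet Φ D w I ⊆ valueSet Φ D w J :=
  image_mono fun _ hξ => ⟨hξ.1, fun i hi => h (hξ.2 i hi)⟩

lemma zero_mem_expansionSet (h0 : (0 : E) ∈ D) (I : Set ℤ) : (0 : ℤ → E) ∈ expansionSet D w I :=
  ⟨isWNAF_iff.2 ⟨fun _ => h0, fun _ _ _ _ => Or.inl rfl⟩, fun _ h => absurd rfl h⟩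

lemma zero_mem_valueSet (h0 : (0 : E) ∈ D) (I : Set ℤ) : (0 : E) ∈ valueSet Φ D w I :=
  ⟨0, zero_mem_expansionSet h0 I, by simp [value]⟩

lemma valueSet_empty (h0 : (0 : E) ∈ D) : valueSet Φ D w ∅ = {0} := by
  refine Subset.antisymm ?_ (singleton_subset_iff.2 (zero_mem_valueSet h0 _))
  rintro _ ⟨ξ, hξ, rfl⟩
  have : ξ = 0 := funext fun i => by
    by_contra h
    exact hξ.2 i h
  simp [this, value]

lemma leftLength_le_zero {ξ : ℤ → E} : leftLength ξ ≤ 0 ↔ ∀ i, ξ i ≠ 0 → i ∈ Iio (0 : ℤ) := by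
  simp only [leftLength, iSup_le_iff, mem_ofPred_eq, mem_Iio]
  refine forall₂_congr fun i _ => ?_
  rw [← Nat.cast_zero, Nat.cast_le]
  omega

lemma rightLength_le {ξ : ℤ → E} (m : ℕ) :
    rightLength ξ ≤ m ↔ ∀ i, ξ i ≠ 0 → i ∈ Ici (-(m : ℤ)) := by
  simp only [rightLength, iSup_le_iff, mem_ofPred_eq, mem_Ici]
  refine forall₂_congr fun i _ => ?_
  rw [Nat.cast_le]
  omega

lemma wnafSet_zero_top : wnafSet D w 0 ⊤ = expansionSet D w (Iio 0) := by
  ext ξ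
  simp only [wnafSet, expansionSet, mem_ofPred_eq, le_top, and_true, leftLength_le_zero]

lemma wnafSet_zero_natCast (m : ℕ) :
    wnafSet D w 0 (m : ℕ∞) = expansionSet D w (Ico (-(m : ℤ)) 0) := by
  ext ξ
  simp only [wnafSet, expansionSet, mem_ofPred_eq, leftLength_le_zero, rightLength_le, ← forall_and,
    mem_Ico, mem_Iio, mem_Ici]
  refine and_congr_right fun _ => forall_congr' fun i => ?_
  tauto

lemma fundDomain_eq_valueSet : fundDomain Φ D w = valueSet Φ D w (Iio 0) := by
  rw [fundDomain, wnafSet_zero_top, valueSet]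

/-! ### Convergence -/

lemma summable_bound (hρ : 1 < ρ) (C : ℝ) (b : ℤ) :
    Summable fun j : ℤ => if j < b then ρ ^ j * C else 0 := by
  have hρ0 : ρ ≠ 0 := by positivity
  rw [summable_int_iff_summable_nat_and_neg]
  constructor
  · refine summable_of_hasFiniteSupport ((Set.finite_lt_nat b.toNat).subset ?_)
    intro m hm
    simp only [Function.mem_support, ne_eq, ite_eq_right_iff, not_forall] at hm
    obtain ⟨h, -⟩ := hm
    simp only [mem_ofPred_eq]
    omega
  · have h1 : Summable fun m : ℕ => (ρ⁻¹) ^ m * |C| :=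
      (summable_geometric_of_lt_one (by positivity) (inv_lt_one_of_one_lt₀ hρ)).mul_right _
    refine Summable.of_norm_bounded h1 fun m => ?_
    split_ifs
    · rw [zpow_neg, zpow_natCast, norm_mul, norm_inv, norm_pow, inv_pow, Real.norm_eq_abs,
        Real.norm_eq_abs, abs_of_pos (by positivity : 0 < ρ)]
    · rw [norm_zero]; positivity

lemma exists_norm_bound (hDf : D.Finite) : ∃ C, ∀ d ∈ D, ‖d‖ ≤ C :=
  hDf.isBounded.exists_norm_le

lemma norm_term_le (hρ : 1 < ρ) (hΦ : ∀ x, ‖Φ x‖ = ρ * ‖x‖) {C : ℝ} (hC : ∀ d ∈ D, ‖d‖ ≤ C)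
    {I : Set ℤ} {b : ℤ} (hI : I ⊆ Iio b) {ξ : ℤ → E} (hξ : ξ ∈ expansionSet D w I) (j : ℤ) :
    ‖(Φ ^ j) (ξ j)‖ ≤ if j < b then ρ ^ j * C else 0 := by
  split_ifs with h
  · rw [norm_zpow_apply hρ hΦ]
    have := hC _ (hξ.1.mem j)
    gcongr
  · have : ξ j = 0 := by
      by_contra h'
      exact h (hI (hξ.2 j h'))
    simp [this]

lemma summable_value [CompleteSpace E] (hρ : 1 < ρ) (hΦ : ∀ x, ‖Φ x‖ = ρ * ‖x‖) (hDf : D.Finite)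
    {I : Set ℤ} {b : ℤ} (hI : I ⊆ Iio b) {ξ : ℤ → E} (hξ : ξ ∈ expansionSet D w I) :
    Summable fun j : ℤ => (Φ ^ j) (ξ j) := by
  obtain ⟨C, hC⟩ := exists_norm_bound hDf
  exact Summable.of_norm_bounded (summable_bound hρ C b) (norm_term_le hρ hΦ hC hI hξ)

/-! ### Splitting off a digit, and shifting -/

lemma value_update [CompleteSpace E] (hρ : 1 < ρ) (hΦ : ∀ x, ‖Φ x‖ = ρ * ‖x‖) (hDf : D.Finite)
    {I : Set ℤ} {b : ℤ} (hI : I ⊆ Iio b) {ξ : ℤ → E} (hξ : ξ ∈ expansionSet D w I) (i : ℤ) :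
    value Φ ξ = (Φ ^ i) (ξ i) + value Φ (Function.update ξ i 0) := by
  rw [value, (summable_value hρ hΦ hDf hI hξ).tsum_eq_add_tsum_ite i, value]
  congr 1
  refine tsum_congr fun j => ?_
  by_cases h : j = i
  · subst h; simp
  · simp [h]

/-- A non-zero digit at `i` forces zeros at distance less than `w` and imposes nothing else, so
erasing and inserting it are inverse operations. -/
lemma image_value_digit [CompleteSpace E] (hρ : 1 < ρ) (hΦ : ∀ x, ‖Φ x‖ = ρ * ‖x‖)
    (hDf : D.Finite) (h0 : (0 : E) ∈ D) {I : Set ℤ} {b : ℤ} (hI : I ⊆ Iio b) {i : ℤ}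
    (hi : i ∈ I) {η : E} (hη : η ∈ D) (hη0 : η ≠ 0) :
    value Φ '' {ξ | ξ ∈ expansionSet D w I ∧ ξ i = η}
      = (Φ ^ i) η +ᵥ valueSet Φ D w ((I \ {i}) \ Ioo (i - w) (i + w)) := by
  ext x
  simp only [mem_image, mem_vadd_set, valueSet, vadd_eq_add]
  constructor
  · rintro ⟨ξ, ⟨hξ, rfl⟩, rfl⟩
    refine ⟨_, ⟨Function.update ξ i 0, ⟨isWNAF_iff.2 ⟨fun j => ?_, fun j k hjk hkj => ?_⟩,
      fun j hj => ?_⟩, rfl⟩, (value_update hρ hΦ hDf hI hξ i).symm⟩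
    · by_cases h : j = i
      · subst h; simpa using h0
      · simpa [h] using hξ.1.mem j
    · by_cases h : j = i
      · subst h; simp
      · by_cases h' : k = i
        · subst h'; simp
        · simpa [h, h'] using (isWNAF_iff.1 hξ.1).2 j k hjk hkj
    · have h : j ≠ i := by rintro rfl; simp at hj
      rw [Function.update_of_ne h] at hj
      refine ⟨⟨hξ.2 j hj, h⟩, fun hji => ?_⟩
      rcases lt_or_gt_of_ne h with h' | h'
      · rcases (isWNAF_iff.1 hξ.1).2 j i h' (by linarith [hji.1]) with h'' | h'' <;> contradiction
      · rcases (isWNAF_iff.1 hξ.1).2 i j h' hji.2 with h'' | h'' <;> contradiction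
  · rintro ⟨_, ⟨ξ, hξ, rfl⟩, rfl⟩
    have hξi : ξ i = 0 := by
      by_contra h
      exact (hξ.2 i h).1.2 rfl
    have hmem : Function.update ξ i η ∈ expansionSet D w I := by
      have key : ∀ j, j ≠ i → i - w < j → j < i + w → ξ j = 0 := fun j _ h1 h2 => by
        by_contra h
        exact (hξ.2 j h).2 ⟨h1, h2⟩
      refine ⟨isWNAF_iff.2 ⟨fun j => ?_, fun j k hjk hkj => ?_⟩, fun j hj => ?_⟩
      · by_cases h : j = i
        · subst h; simpa using hη
        · simpa [h] using hξ.1.mem j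
      · by_cases h : j = i
        · subst h
          right
          rw [Function.update_of_ne hjk.ne']
          exact key k hjk.ne' (by omega) hkj
        · by_cases h' : k = i
          · subst h'
            left
            rw [Function.update_of_ne h]
            exact key j h (by omega) (by omega)
          · simpa [h, h'] using (isWNAF_iff.1 hξ.1).2 j k hjk hkj
      · by_cases h : j = i
        · rwa [h]
        · rw [Function.update_of_ne h] at hj
          exact (hξ.2 j hj).1.1
    refine ⟨_, ⟨hmem, by simp⟩, ?_⟩
    rw [value_update hρ hΦ hDf hI hmem i]
    simp [← hξi]

lemma valueSet_split [CompleteSpace E] (hρ : 1 < ρ) (hΦ : ∀ x, ‖Φ x‖ = ρ * ‖x‖)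
    (hDf : D.Finite) (h0 : (0 : E) ∈ D) {I : Set ℤ} {b : ℤ} (hI : I ⊆ Iio b) {i : ℤ}
    (hi : i ∈ I) :
    valueSet Φ D w I = valueSet Φ D w (I \ {i}) ∪
      ⋃ η ∈ D \ {0}, (Φ ^ i) η +ᵥ valueSet Φ D w ((I \ {i}) \ Ioo (i - w) (i + w)) := by
  apply Subset.antisymm
  · rintro _ ⟨ξ, hξ, rfl⟩
    by_cases h : ξ i = 0
    · refine Or.inl ⟨ξ, ⟨hξ.1, fun j hj => ⟨hξ.2 j hj, ?_⟩⟩, rfl⟩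
      rintro rfl
      exact hj h
    · refine Or.inr (mem_biUnion (⟨hξ.1.mem i, h⟩ : ξ i ∈ D \ {0}) ?_)
      rw [← image_value_digit hρ hΦ hDf h0 hI hi (hξ.1.mem i) h]
      exact ⟨ξ, ⟨hξ, rfl⟩, rfl⟩
  · refine union_subset (valueSet_mono sdiff_subset) (iUnion₂_subset fun η hη => ?_)
    rw [← image_value_digit hρ hΦ hDf h0 hI hi hη.1 hη.2]
    exact image_mono fun ξ hξ => hξ.1

/-- No summability is needed: an invertible continuous linear map commutes with `tsum` even at its
default value. -/
lemma value_shift (Φ : E ≃L[ℝ] E) (k : ℤ) (ξ : ℤ → E) :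
    value Φ (fun j => ξ (j - k)) = (Φ ^ k) (value Φ ξ) := by
  rw [value, value, ContinuousLinearEquiv.map_tsum, ← (Equiv.addRight k).tsum_eq]
  refine tsum_congr fun j => ?_
  simp only [Equiv.coe_addRight, add_sub_cancel_right]
  rw [add_comm, zpow_add_apply]

lemma expansionSet_shift {I J : Set ℤ} {k : ℤ} (hIJ : ∀ i, i ∈ I ↔ i + k ∈ J) {ξ : ℤ → E}
    (hξ : ξ ∈ expansionSet D w I) : (fun j => ξ (j - k)) ∈ expansionSet D w J := by
  refine ⟨isWNAF_iff.2 ⟨fun j => hξ.1.mem _, fun i j hij hji => ?_⟩, fun i hi => ?_⟩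
  · exact (isWNAF_iff.1 hξ.1).2 _ _ (by omega) (by omega)
  · simpa using (hIJ _).1 (hξ.2 _ hi)

lemma image_zpow_valueSet (Φ : E ≃L[ℝ] E) {I J : Set ℤ} {k : ℤ} (hIJ : ∀ i, i ∈ I ↔ i + k ∈ J) :
    (Φ ^ k) '' valueSet Φ D w I = valueSet Φ D w J := by
  ext x
  constructor
  · rintro ⟨_, ⟨ξ, hξ, rfl⟩, rfl⟩
    exact ⟨_, expansionSet_shift hIJ hξ, value_shift Φ k ξ⟩
  · rintro ⟨ξ, hξ, rfl⟩
    refine ⟨_, ⟨_, expansionSet_shift (k := -k) (J := I) (fun i => ?_) hξ, rfl⟩, ?_⟩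
    · rw [hIJ]; simp
    · rw [value_shift, zpow_zpow_neg_apply]

/-! ### Compactness and approximation by finite expansions -/

lemma isCompact_expansionSet (hDf : D.Finite) (I : Set ℤ) : IsCompact (expansionSet D w I) := by
  have h : expansionSet D w I = univ.pi (fun _ => D) ∩
      ((⋂ (i : ℤ) (k : ℤ) (_ : i < k) (_ : k < i + w), {ξ : ℤ → E | ξ i = 0 ∨ ξ k = 0}) ∩
        ⋂ (i : ℤ) (_ : i ∉ I), {ξ : ℤ → E | ξ i = 0}) := by
    ext ξ
    simp only [expansionSet, isWNAF_iff, mem_ofPred_eq, mem_inter_iff, mem_univ_pi, mem_iInter,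
      and_assoc]
    refine and_congr_right fun _ => and_congr_right fun _ => forall_congr' fun i => ?_
    rw [← not_imp_not, not_not]
  rw [h]
  refine (isCompact_univ_pi fun _ => hDf.isCompact).inter_right (IsClosed.inter ?_ ?_)
  · refine isClosed_iInter fun i => isClosed_iInter fun k => isClosed_iInter fun _ =>
      isClosed_iInter fun _ => IsClosed.union ?_ ?_
    · exact isClosed_eq (continuous_apply i) continuous_const
    · exact isClosed_eq (continuous_apply k) continuous_const
  · exact isClosed_iInter fun i => isClosed_iInter fun _ =>
      isClosed_eq (continuous_apply i) continuous_const

/-- The geometric majorant is uniform in the sequence, so `value` is continuous on a set that is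
compact by Tychonoff. -/
lemma isCompact_valueSet [CompleteSpace E] (hρ : 1 < ρ) (hΦ : ∀ x, ‖Φ x‖ = ρ * ‖x‖)
    (hDf : D.Finite) {I : Set ℤ} {b : ℤ} (hI : I ⊆ Iio b) : IsCompact (valueSet Φ D w I) := by
  obtain ⟨C, hC⟩ := exists_norm_bound hDf
  refine (isCompact_expansionSet hDf I).image_of_continuousOn ?_
  refine continuousOn_tsum (fun j => ?_) (summable_bound hρ C b)
    (fun j ξ hξ => norm_term_le hρ hΦ hC hI hξ j)
  exact ((Φ ^ j).continuous.comp (continuous_apply j)).continuousOn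

/-- Replacing digits by zero preserves non-adjacency, so the partial sums are themselves values. -/
lemma valueSet_subset_closure [CompleteSpace E] (hρ : 1 < ρ) (hΦ : ∀ x, ‖Φ x‖ = ρ * ‖x‖)
    (hDf : D.Finite) (h0 : (0 : E) ∈ D) {I : Set ℤ} {b : ℤ} (hI : I ⊆ Iio b) :
    valueSet Φ D w I ⊆ closure (⋃ m : ℕ, valueSet Φ D w (I ∩ Ici (-(m : ℤ)))) := by
  rintro _ ⟨ξ, hξ, rfl⟩
  refine mem_closure_of_tendsto (summable_value hρ hΦ hDf hI hξ).hasSum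
    (Eventually.of_forall fun s => ?_)
  obtain ⟨m, hm⟩ : ∃ m : ℕ, ∀ i ∈ s, -(m : ℤ) ≤ i := by
    obtain ⟨a, ha⟩ := s.bddBelow
    exact ⟨(-a).toNat, fun i hi => by have := ha hi; omega⟩
  refine mem_iUnion.2 ⟨m, fun i => if i ∈ s then ξ i else 0, ⟨isWNAF_iff.2 ⟨fun j => ?_,
    fun j k hjk hkj => ?_⟩, fun j hj => ?_⟩, ?_⟩
  · split_ifs
    exacts [hξ.1.mem j, h0]
  · rcases (isWNAF_iff.1 hξ.1).2 j k hjk hkj with h | h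
    · left; simp [h]
    · right; simp [h]
  · simp only [ne_eq, ite_eq_right_iff, not_forall] at hj
    exact ⟨hξ.2 j hj.2, hm j hj.1⟩
  · rw [value, tsum_eq_sum (s := s)]
    · exact Finset.sum_congr rfl fun j hj => by simp [hj]
    · intro j hj
      simp [hj]

end WNAF

/-! ### Digit systems: norm bounds, counting recursion, lattice points among the values. -/

namespace WNAF

variable {E : Type*} [NormedAddCommGroup E] [NormedSpace ℝ E]
variable {Φ : E ≃L[ℝ] E} {ρ : ℝ} {D : Set E} {w : ℕ}

/-- A digit system: a reduced residue digit set inside `Φ ^ w T`, for a similarity `Φ` of ratio `ρ`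
and a tile `T` of the lattice `Λ` with inner radius `r` and outer radius `R`. -/
structure DigitSystem (Λ : Submodule ℤ E) (Φ : E ≃L[ℝ] E) (ρ : ℝ) (T : Set E) (r R : ℝ) (w : ℕ)
    (D : Set E) : Prop where
  one_lt : 1 < ρ
  width_pos : 0 < w
  norm_map : ∀ x, ‖Φ x‖ = ρ * ‖x‖
  map_mem : ∀ z ∈ Λ, Φ z ∈ Λ
  digits : IsReducedResidueDigitSet Λ Φ w D
  finite : D.Finite
  r_pos : 0 < r
  R_pos : 0 < R
  closedBall_subset : Metric.closedBall 0 r ⊆ T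
  subset_closedBall : T ⊆ Metric.closedBall 0 R
  ratio_lt : R / r < ρ ^ w - 1
  digit_mem : D ⊆ (Φ ^ w) '' T
  iUnion_eq : ⋃ z ∈ Λ, (z +ᵥ T) = univ
  inter_subset : ∀ z ∈ Λ, z ≠ 0 → T ∩ (z +ᵥ T) ⊆ frontier T

/-- The values of the non-adjacent forms with non-zero digits at the positions `0, …, m - 1`
only. -/
def intValues (Φ : E ≃L[ℝ] E) (D : Set E) (w m : ℕ) : Set E := valueSet Φ D w (Ico 0 (m : ℤ))

lemma image_zpow_neg_intValues (Φ : E ≃L[ℝ] E) (D : Set E) (w : ℕ) (a b : ℤ) :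
    (Φ ^ a) '' intValues Φ D w (b - a).toNat = valueSet Φ D w (Ico a b) :=
  image_zpow_valueSet Φ fun i => by simp only [mem_Ico]; omega

namespace DigitSystem

variable {Λ : Submodule ℤ E} {T : Set E} {r R : ℝ}

lemma pow_mem (h : DigitSystem Λ Φ ρ T r R w D) (m : ℕ) {z : E} (hz : z ∈ Λ) :
    (Φ ^ m) z ∈ Λ := by
  induction m generalizing z with
  | zero => exact hz
  | succ m ih => rw [pow_succ]; exact ih (h.map_mem z hz)

lemma zpow_mem (h : DigitSystem Λ Φ ρ T r R w D) {k : ℤ} (hk : 0 ≤ k) {z : E} (hz : z ∈ Λ) :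
    (Φ ^ k) z ∈ Λ := by
  lift k to ℕ using hk
  rw [zpow_natCast]
  exact h.pow_mem k hz

lemma norm_zpow (h : DigitSystem Λ Φ ρ T r R w D) (k : ℤ) (x : E) :
    ‖(Φ ^ k) x‖ = ρ ^ k * ‖x‖ := norm_zpow_apply h.one_lt h.norm_map k x

lemma norm_pow (h : DigitSystem Λ Φ ρ T r R w D) (k : ℕ) (x : E) :
    ‖(Φ ^ k) x‖ = ρ ^ k * ‖x‖ := by
  rw [← zpow_natCast_apply, h.norm_zpow, zpow_natCast]

lemma rho_pos (h : DigitSystem Λ Φ ρ T r R w D) : 0 < ρ := zero_lt_one.trans h.one_lt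

lemma pow_sub_one_pos (h : DigitSystem Λ Φ ρ T r R w D) : 0 < ρ ^ w - 1 :=
  lt_of_le_of_lt (div_nonneg h.R_pos.le h.r_pos.le) h.ratio_lt

lemma radius_lt (h : DigitSystem Λ Φ ρ T r R w D) : R / (ρ ^ w - 1) < r := by
  have h1 := h.ratio_lt
  rw [div_lt_iff₀ h.r_pos] at h1
  rw [div_lt_iff₀ h.pow_sub_one_pos]
  linarith

lemma zero_mem_tile (h : DigitSystem Λ Φ ρ T r R w D) : (0 : E) ∈ T :=
  h.closedBall_subset (by simp [h.r_pos.le])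

lemma norm_le_of_mem_tile (h : DigitSystem Λ Φ ρ T r R w D) {x : E} (hx : x ∈ T) : ‖x‖ ≤ R := by
  simpa using h.subset_closedBall hx

lemma mem_interior_tile (h : DigitSystem Λ Φ ρ T r R w D) {x : E} (hx : ‖x‖ < r) :
    x ∈ interior T :=
  mem_interior.2 ⟨Metric.ball 0 r, Metric.ball_subset_closedBall.trans h.closedBall_subset,
    Metric.isOpen_ball, by simpa using hx⟩

/-- Otherwise `p - u` lies in `T` and in a different translate of `T`, hence on the boundary,
although the open ball of radius `r` is interior to `T`. All uniqueness arguments about lattice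
points go back to this. -/
lemma eq_zero_of_mem_tile (h : DigitSystem Λ Φ ρ T r R w D) {p u : E} (hp : p ∈ T) (hu : u ∈ Λ)
    (hpu : ‖p - u‖ < r) : u = 0 := by
  by_contra hu0
  have h1 : p - u ∈ frontier T := by
    refine h.inter_subset (-u) (Λ.neg_mem hu) (neg_ne_zero.2 hu0)
      ⟨interior_subset (h.mem_interior_tile hpu), ?_⟩
    exact mem_vadd_set.2 ⟨p, hp, by rw [vadd_eq_add]; abel⟩
  exact h1.2 (h.mem_interior_tile hpu)

lemma norm_digit_le (h : DigitSystem Λ Φ ρ T r R w D) {d : E} (hd : d ∈ D) : ‖d‖ ≤ ρ ^ w * R := by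
  obtain ⟨t, ht, rfl⟩ := h.digit_mem hd
  rw [h.norm_pow]
  have := h.norm_le_of_mem_tile ht
  have := h.rho_pos
  gcongr

/-! ### Recursions for the integer values -/

lemma valueSet_split_top [CompleteSpace E] (h : DigitSystem Λ Φ ρ T r R w D) {I : Set ℤ} {b : ℤ}
    (hI : I ⊆ Iio (b + 1)) (hb : b ∈ I) :
    valueSet Φ D w I = valueSet Φ D w (I ∩ Iio b) ∪
      ⋃ η ∈ D \ {0}, (Φ ^ b) η +ᵥ valueSet Φ D w (I ∩ Iio (b - w + 1)) := by
  have hw := h.width_pos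
  rw [valueSet_split h.one_lt h.norm_map h.finite h.digits.zero_mem hI hb]
  have h1 : I \ {b} = I ∩ Iio b := by
    ext i
    have : i ∈ I → i < b + 1 := fun hi => hI hi
    simp only [Set.mem_sdiff, mem_singleton_iff, mem_inter_iff, mem_Iio]
    refine and_congr_right fun hi => ?_
    have := this hi
    omega
  rw [h1]
  have h2 : (I ∩ Iio b) \ Ioo (b - w) (b + w) = I ∩ Iio (b - w + 1) := by
    ext i
    simp only [Set.mem_sdiff, mem_inter_iff, mem_Iio, mem_Ioo, and_assoc]
    refine and_congr_right fun hi => ?_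
    omega
  rw [h2]

lemma intValues_zero (h : DigitSystem Λ Φ ρ T r R w D) : intValues Φ D w 0 = {0} := by
  rw [intValues, Nat.cast_zero, Ico_self, valueSet_empty h.digits.zero_mem]

lemma intValues_succ [CompleteSpace E] (h : DigitSystem Λ Φ ρ T r R w D) (m : ℕ) :
    intValues Φ D w (m + 1) = intValues Φ D w m ∪
      ⋃ η ∈ D \ {0}, (Φ ^ m) η +ᵥ intValues Φ D w (m + 1 - w) := by
  have hw := h.width_pos
  rw [intValues, h.valueSet_split_top (I := Ico 0 ((m + 1 : ℕ) : ℤ)) (b := m)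
    (fun i hi => by simp only [mem_Ico, mem_Iio] at *; omega) (by simp only [mem_Ico]; omega)]
  have h1 : Ico 0 ((m + 1 : ℕ) : ℤ) ∩ Iio (m : ℤ) = Ico 0 (m : ℤ) := by
    ext i; simp only [mem_inter_iff, mem_Ico, mem_Iio]; omega
  have h2 : Ico 0 ((m + 1 : ℕ) : ℤ) ∩ Iio ((m : ℤ) - w + 1) = Ico 0 ((m + 1 - w : ℕ) : ℤ) := by
    ext i; simp only [mem_inter_iff, mem_Ico, mem_Iio]; omega
  simp only [zpow_natCast, h1, h2, intValues]

lemma intValues_succ_bottom [CompleteSpace E] (h : DigitSystem Λ Φ ρ T r R w D) (m : ℕ) :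
    intValues Φ D w (m + 1) = Φ '' intValues Φ D w m ∪
      ⋃ η ∈ D \ {0}, η +ᵥ (Φ ^ w) '' intValues Φ D w (m + 1 - w) := by
  have hw := h.width_pos
  rw [intValues, valueSet_split h.one_lt h.norm_map h.finite h.digits.zero_mem
    (I := Ico 0 ((m + 1 : ℕ) : ℤ)) (b := m + 1) (i := 0)
    (fun i hi => by simp only [mem_Ico, mem_Iio] at *; omega) (by simp only [mem_Ico]; omega)]
  have h1 : Φ '' intValues Φ D w m = valueSet Φ D w (Ico 0 ((m + 1 : ℕ) : ℤ) \ {0}) := by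
    rw [← zpow_one Φ, intValues, zpow_one Φ]
    nth_rw 1 [← zpow_one Φ]
    exact image_zpow_valueSet Φ fun i => by
      simp only [Set.mem_sdiff, mem_singleton_iff, mem_Ico]; omega
  have h2 : (Φ ^ w) '' intValues Φ D w (m + 1 - w)
      = valueSet Φ D w ((Ico 0 ((m + 1 : ℕ) : ℤ) \ {0}) \ Ioo (0 - (w : ℤ)) (0 + w)) := by
    rw [intValues, ← zpow_natCast Φ]
    exact image_zpow_valueSet Φ fun i => by
      simp only [Set.mem_sdiff, mem_singleton_iff, mem_Ico, mem_Ioo]; omega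
  rw [h1, h2]
  simp only [zpow_zero_apply]

lemma intValues_subset [CompleteSpace E] (h : DigitSystem Λ Φ ρ T r R w D) (m : ℕ) :
    intValues Φ D w m ⊆ Λ := by
  induction m using Nat.strong_induction_on with
  | _ m ih =>
    rcases m with _ | m
    · rw [h.intValues_zero]
      exact singleton_subset_iff.2 Λ.zero_mem
    · have hw := h.width_pos
      rw [h.intValues_succ]
      refine union_subset (ih m (by omega)) (iUnion₂_subset fun η hη => ?_)
      rintro _ ⟨z, hz, rfl⟩
      exact Λ.add_mem (h.pow_mem m (h.digits.subset hη.1)) (ih _ (by omega) hz)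

lemma finite_intValues [CompleteSpace E] (h : DigitSystem Λ Φ ρ T r R w D) (m : ℕ) :
    (intValues Φ D w m).Finite := by
  induction m using Nat.strong_induction_on with
  | _ m ih =>
    rcases m with _ | m
    · rw [h.intValues_zero]
      exact finite_singleton 0
    · have hw := h.width_pos
      rw [h.intValues_succ]
      refine (ih m (by omega)).union (h.finite.sdiff.biUnion fun η _ => ?_)
      exact (ih _ (by omega)).image _

/-- The extra `R` leaves room for a tile around `z`, so one bound serves the values and the cell
coverings. Peeling off the top digit closes the induction, because 1 + 1/(ρ^w - 1) = ρ^w/(ρ^w - 1).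
-/
lemma norm_intValues_le [CompleteSpace E] (h : DigitSystem Λ Φ ρ T r R w D) (m : ℕ) :
    ∀ z ∈ intValues Φ D w m, ‖z‖ + R ≤ R / (ρ ^ w - 1) * ρ ^ (m + 2 * w - 1) := by
  have hw := h.width_pos
  have hpos := h.pow_sub_one_pos
  have hR := h.R_pos
  have hρ := h.one_lt
  have hρ0 := h.rho_pos
  have base : ∀ k : ℕ, w ≤ k → R ≤ R / (ρ ^ w - 1) * ρ ^ k := fun k hk => by
    rw [div_mul_eq_mul_div, le_div_iff₀ hpos]
    have : ρ ^ w ≤ ρ ^ k := pow_le_pow_right₀ hρ.le hk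
    nlinarith
  induction m using Nat.strong_induction_on with
  | _ m ih =>
    rcases m with _ | m
    · rw [h.intValues_zero]
      rintro z rfl
      rw [norm_zero, zero_add]
      exact base _ (by omega)
    · rw [h.intValues_succ]
      rintro z (hz | hz)
      · refine (ih m (by omega) z hz).trans ?_
        gcongr
        · exact hρ.le
        · omega
      · obtain ⟨η, hη, hz⟩ := mem_iUnion₂.1 hz
        obtain ⟨y, hy, rfl⟩ := hz
        change ‖(Φ ^ m) η + y‖ + R ≤ _
        have h1 : ‖y‖ + R ≤ R / (ρ ^ w - 1) * ρ ^ (m + w) := by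
          rcases le_or_gt w (m + 1) with hm | hm
          · have := ih _ (by omega) y hy
            rwa [show m + 1 - w + 2 * w - 1 = m + w by omega] at this
          -- Below a leading digit at a position less than `w - 1` no further digit fits.
          · rw [show m + 1 - w = 0 by omega, h.intValues_zero] at hy
            rw [mem_singleton_iff.1 hy, norm_zero, zero_add]
            exact base _ (by omega)
        have h2 : ‖(Φ ^ m) η‖ ≤ ρ ^ m * (ρ ^ w * R) := by
          rw [h.norm_pow]
          have := h.norm_digit_le hη.1
          gcongr
        calc ‖(Φ ^ m) η + y‖ + R ≤ ‖(Φ ^ m) η‖ + (‖y‖ + R) := by linarith [norm_add_le ((Φ ^ m) η) y]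
          _ ≤ ρ ^ m * (ρ ^ w * R) + R / (ρ ^ w - 1) * ρ ^ (m + w) := add_le_add h2 h1
          _ = R / (ρ ^ w - 1) * ρ ^ (m + 1 + 2 * w - 1) := by
            rw [show m + 1 + 2 * w - 1 = m + w + w by omega, pow_add ρ (m + w) w, pow_add]
            field_simp
            ring

/-- The count satisfies the recursion of the non-adjacent forms by their lowest digit. -/
lemma ncard_intValues_succ [CompleteSpace E] (h : DigitSystem Λ Φ ρ T r R w D) (m : ℕ) :
    (intValues Φ D w (m + 1)).ncard = (intValues Φ D w m).ncard +
      (D \ {0}).ncard * (intValues Φ D w (m + 1 - w)).ncard := by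
  have hw := h.width_pos
  have hpw : ∀ y ∈ Λ, (Φ ^ w) y ∈ Φ '' (Λ : Set E) := fun y hy => by
    refine ⟨(Φ ^ (w - 1)) y, h.pow_mem _ hy, ?_⟩
    conv_rhs => rw [show w = 1 + (w - 1) by omega, pow_add, pow_one]
    rfl
  have himage : ⋃ η ∈ D \ {0}, η +ᵥ (Φ ^ w) '' intValues Φ D w (m + 1 - w) =
      (fun p : E × E => p.1 + (Φ ^ w) p.2) '' ((D \ {0}) ×ˢ intValues Φ D w (m + 1 - w)) := by
    ext x
    simp only [mem_iUnion, mem_vadd_set, mem_image, mem_prod, Prod.exists, vadd_eq_add,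
      exists_prop]
    constructor
    · rintro ⟨η, hη, _, ⟨y, hy, rfl⟩, rfl⟩
      exact ⟨η, y, ⟨hη, hy⟩, rfl⟩
    · rintro ⟨η, y, ⟨hη, hy⟩, rfl⟩
      exact ⟨η, hη, _, ⟨y, hy, rfl⟩, rfl⟩
  rw [h.intValues_succ_bottom, himage, ncard_union_eq ?_ ((h.finite_intValues m).image _)
    ((h.finite.sdiff.prod (h.finite_intValues _)).image _), ncard_image_of_injective _ Φ.injective,
    InjOn.ncard_image, ncard_prod]
  -- The residue class modulo Φ^w Λ recovers the lowest digit, and then `y` follows.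
  · rintro ⟨η, y⟩ ⟨hη, hy⟩ ⟨η', y'⟩ ⟨hη', hy'⟩ heq
    have hη := hη.1
    have hη0 := (show η ∈ D \ {0} by assumption).2
    have hη' := hη'.1
    simp only at heq hy hy'
    have hyΛ := h.intValues_subset _ hy
    have hyΛ' := h.intValues_subset _ hy'
    have h1 : η = η' := by
      have hzΛ := h.digits.subset hη
      refine (h.digits.existsUnique η hzΛ (h.digits.notMem_image η hη hη0)).unique
        ⟨hη, ?_⟩ ⟨hη', ?_⟩
      · rw [sub_self]; exact ⟨0, Λ.zero_mem, map_zero _⟩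
      · refine ⟨y' - y, Λ.sub_mem hyΛ' hyΛ, ?_⟩
        rw [map_sub]
        exact (sub_eq_sub_iff_add_eq_add.2 (by rw [heq, add_comm])).symm
    subst h1
    rw [(Φ ^ w).injective (add_left_cancel heq)]
  -- A value with lowest digit `η ≠ 0` is not divisible by Φ, since `η` is not.
  · rw [Set.disjoint_left]
    rintro _ ⟨x, hx, rfl⟩ ⟨⟨η, y⟩, ⟨hη, hy⟩, heq⟩
    simp only at heq hy
    refine h.digits.notMem_image η hη.1 hη.2 ?_
    obtain ⟨y', hy', hyy⟩ := hpw y (h.intValues_subset _ hy)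
    refine ⟨x - y', Λ.sub_mem (h.intValues_subset _ hx) hy', ?_⟩
    rw [map_sub, ← heq, hyy, add_sub_cancel_right]

/-! ### Fractional values -/

/-- Finite expansions are rescaled integer values, and the closed ball absorbs their limits. -/
lemma norm_valueSet_le [CompleteSpace E] (h : DigitSystem Λ Φ ρ T r R w D) {x : E}
    (hx : x ∈ valueSet Φ D w (Iio (-2 * (w : ℤ) + 1))) : ‖x‖ ≤ R / (ρ ^ w - 1) := by
  have hρ0 := h.rho_pos
  have hR := h.R_pos
  have hpos := h.pow_sub_one_pos
  have h1 : closure (⋃ m : ℕ, valueSet Φ D w (Iio (-2 * (w : ℤ) + 1) ∩ Ici (-(m : ℤ))))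
      ⊆ Metric.closedBall 0 (R / (ρ ^ w - 1)) := by
    refine closure_minimal (iUnion_subset fun m => ?_) Metric.isClosed_closedBall
    rw [inter_comm, Ici_inter_Iio, ← image_zpow_neg_intValues]
    rintro _ ⟨z, hz, rfl⟩
    rw [mem_closedBall_zero_iff]
    rcases le_or_gt (2 * w - 1) m with hm | hm
    · have h2 := h.norm_intValues_le _ z hz
      rw [show (-2 * (w : ℤ) + 1 - -(m : ℤ)).toNat + 2 * w - 1 = m by
        have := h.width_pos; omega] at h2
      rw [h.norm_zpow, zpow_neg, zpow_natCast, inv_mul_le_iff₀ (by positivity)]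
      linarith
    · rw [show (-2 * (w : ℤ) + 1 - -(m : ℤ)).toNat = 0 by omega, h.intValues_zero] at hz
      rw [mem_singleton_iff.1 hz, map_zero, norm_zero]
      positivity
  simpa using h1 (valueSet_subset_closure h.one_lt h.norm_map h.finite h.digits.zero_mem
    subset_rfl hx)

lemma exists_leading_digit [CompleteSpace E] (h : DigitSystem Λ Φ ρ T r R w D) {b : ℤ} {x : E}
    (hx : x ∈ valueSet Φ D w (Iio b)) (hx0 : x ≠ 0) :
    ∃ k < b, ∃ η ∈ D, η ≠ 0 ∧ ∃ y ∈ valueSet Φ D w (Iio (1 - w)), x = (Φ ^ k) (η + y) := by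
  have hw := h.width_pos
  obtain ⟨ξ, hξ, rfl⟩ := hx
  obtain ⟨k, hk0, hk⟩ := Int.exists_greatest_of_bdd (P := fun k => ξ k ≠ 0)
    ⟨b, fun z hz => (hξ.2 z hz).le⟩ (by
      by_contra! hc
      exact hx0 (by simp [value, hc]))
  refine ⟨k, hξ.2 k hk0, ξ k, hξ.1.mem k, hk0, ?_⟩
  have h1 : value Φ ξ ∈ value Φ '' {ξ' | ξ' ∈ expansionSet D w (Iio (k + 1)) ∧ ξ' k = ξ k} :=
    ⟨ξ, ⟨⟨hξ.1, fun i hi => Int.lt_add_one_of_le (hk i hi)⟩, rfl⟩, rfl⟩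
  rw [image_value_digit h.one_lt h.norm_map h.finite h.digits.zero_mem (b := k + 1) subset_rfl
    (by simp) (hξ.1.mem k) hk0, ← image_zpow_valueSet Φ (k := k) (I := Iio (1 - w))] at h1
  · obtain ⟨_, ⟨y, hy, rfl⟩, hxy⟩ := h1
    exact ⟨y, hy, by rw [map_add, ← hxy]; rfl⟩
  · intro i
    simp only [Set.mem_sdiff, mem_Iio, mem_singleton_iff, mem_Ioo]
    omega

lemma norm_zpow_neg_lt [CompleteSpace E] (h : DigitSystem Λ Φ ρ T r R w D) {y : E}
    (hy : y ∈ valueSet Φ D w (Iio (1 - w))) : ‖(Φ ^ (-(w : ℤ))) y‖ < r := by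
  refine (h.norm_valueSet_le ?_).trans_lt h.radius_lt
  rw [← image_zpow_valueSet Φ (k := -(w : ℤ)) (I := Iio (1 - w))]
  · exact mem_image_of_mem _ hy
  · intro i; simp only [mem_Iio]; omega

/-- Here the leading position is so low that scaling the leading digit into `T` multiplies by a
non-negative power of Φ. The result is a lattice point within `r` of a point of `T`, hence 0. -/
lemma eq_zero_of_mem_valueSet_Iio_one_sub [CompleteSpace E] (h : DigitSystem Λ Φ ρ T r R w D)
    {x : E} (hx : x ∈ valueSet Φ D w (Iio (1 - w))) (hxΛ : x ∈ Λ) : x = 0 := by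
  by_contra hx0
  obtain ⟨k, hk, η, hη, hη0, y, hy, rfl⟩ := h.exists_leading_digit hx hx0
  obtain ⟨t, ht, rfl⟩ := h.digit_mem hη
  have hu : (Φ ^ (-k - w)) ((Φ ^ k) ((Φ ^ w) t + y)) ∈ Λ := h.zpow_mem (by omega) hxΛ
  have hu2 : (Φ ^ (-k - w)) ((Φ ^ k) ((Φ ^ w) t + y)) = t + (Φ ^ (-(w : ℤ))) y := by
    rw [← zpow_add_apply, show -k - w + k = -(w : ℤ) by ring, map_add, ← zpow_natCast_apply,
      zpow_neg_zpow_apply]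
  have h0 : t + (Φ ^ (-(w : ℤ))) y = 0 := by
    rw [hu2] at hu
    refine h.eq_zero_of_mem_tile ht hu ?_
    rw [sub_add_cancel_left, norm_neg]
    exact h.norm_zpow_neg_lt hy
  rw [h0] at hu2
  refine hx0 ((Φ ^ (-k - w)).injective ?_)
  rw [hu2, map_zero]

/-- The only lattice point among the fractional values is the origin. -/
lemma eq_zero_of_mem_valueSet_Iio [CompleteSpace E] (h : DigitSystem Λ Φ ρ T r R w D)
    {x : E} (hx : x ∈ valueSet Φ D w (Iio 0)) (hxΛ : x ∈ Λ) : x = 0 := by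
  by_contra hx0
  obtain ⟨k, hk, η, hη, hη0, y, hy, rfl⟩ := h.exists_leading_digit hx hx0
  have h1 : (Φ ^ (-k)) ((Φ ^ k) (η + y)) = η + y := zpow_neg_zpow_apply Φ k _
  -- Moving the leading digit to position 0 keeps the point in Λ, so the tail is a lattice point and
  -- vanishes. The leading digit would then be divisible by Φ.
  have hyΛ : y ∈ Λ := by
    have h2 : η + y ∈ Λ := h1 ▸ h.zpow_mem (by omega) hxΛ
    simpa using Λ.sub_mem h2 (h.digits.subset hη)
  have hy0 := h.eq_zero_of_mem_valueSet_Iio_one_sub hy hyΛ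
  rw [hy0, add_zero] at h1 hxΛ
  refine h.digits.notMem_image η hη hη0 ⟨(Φ ^ (-k - 1)) ((Φ ^ k) η), h.zpow_mem (by omega) hxΛ, ?_⟩
  rw [← zpow_one_apply Φ, ← zpow_add_apply, show 1 + (-k - 1) = -k by ring, h1]

lemma mem_intValues_of_mem_lattice [CompleteSpace E] (h : DigitSystem Λ Φ ρ T r R w D) (m : ℕ)
    {x : E} (hx : x ∈ valueSet Φ D w (Iio m)) (hxΛ : x ∈ Λ) : x ∈ intValues Φ D w m := by
  have hw := h.width_pos
  induction m using Nat.strong_induction_on generalizing x with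
  | _ m ih =>
    rcases m with _ | m
    · rw [h.intValues_zero]
      exact h.eq_zero_of_mem_valueSet_Iio (by simpa using hx) hxΛ
    · rw [h.valueSet_split_top (I := Iio ((m + 1 : ℕ) : ℤ)) (b := m)
        (fun i hi => by simp only [mem_Iio] at *; omega) (by simp only [mem_Iio]; omega)] at hx
      rw [h.intValues_succ]
      rcases hx with hx | hx
      · exact Or.inl (ih m (by omega) (valueSet_mono inter_subset_right hx) hxΛ)
      · obtain ⟨η, hη, y, hy, rfl⟩ := mem_iUnion₂.1 hx
        rw [zpow_natCast] at hxΛ ⊢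
        refine Or.inr (mem_iUnion₂.2 ⟨η, hη, y, ih _ (by omega) ?_ ?_, rfl⟩)
        · refine valueSet_mono (fun i hi => ?_) hy
          simp only [mem_inter_iff, mem_Iio] at *; omega
        · simpa using Λ.sub_mem hxΛ (h.pow_mem m (h.digits.subset hη.1))

/-! ### Characteristic sets as translates -/

lemma charSet_eq [CompleteSpace E] (h : DigitSystem Λ Φ ρ T r R w D) {η : E} (hη : η ∈ D)
    (hη0 : η ≠ 0) :
    charSet Φ D w η = (Φ ^ (-(w : ℤ))) η +ᵥ valueSet Φ D w (Iio (-2 * (w : ℤ) + 1)) := by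
  have hw := h.width_pos
  rw [charSet, wnafSet_zero_top, image_value_digit h.one_lt h.norm_map h.finite h.digits.zero_mem
    (b := 0) subset_rfl (by simp only [mem_Iio]; omega) hη hη0]
  congr 2
  ext i; simp only [Set.mem_sdiff, mem_singleton_iff, mem_Iio, mem_Ioo]; omega

lemma charSetLevel_eq_valueSet [CompleteSpace E] (h : DigitSystem Λ Φ ρ T r R w D) {η : E}
    (hη : η ∈ D) (hη0 : η ≠ 0) (j : ℕ) :
    charSetLevel Φ D w η j = (Φ ^ (-(w : ℤ))) η +ᵥ
      valueSet Φ D w (Ico (-((j : ℤ) + w)) (-2 * (w : ℤ) + 1)) := by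
  have hw := h.width_pos
  rw [charSetLevel, wnafSet_zero_natCast, image_value_digit h.one_lt h.norm_map h.finite
    h.digits.zero_mem (b := 0) (fun i hi => hi.2) (by simp only [mem_Ico]; omega) hη hη0]
  congr 2
  ext i; simp only [Set.mem_sdiff, mem_singleton_iff, mem_Ico, mem_Ioo]; omega

lemma charSetLevel_eq [CompleteSpace E] (h : DigitSystem Λ Φ ρ T r R w D) {η : E}
    (hη : η ∈ D) (hη0 : η ≠ 0) (j : ℕ) :
    charSetLevel Φ D w η j = (Φ ^ (-((j : ℤ) + w))) '' ((Φ ^ j) η +ᵥ intValues Φ D w (j + 1 - w)) := by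
  rw [h.charSetLevel_eq_valueSet hη hη0, ← image_zpow_neg_intValues, image_clm_vadd,
    ← zpow_natCast_apply, ← zpow_add_apply]
  congr 3
  · ring
  · omega

/-! ### The approximations -/

lemma charApprox_eq [CompleteSpace E] (h : DigitSystem Λ Φ ρ T r R w D) {η : E} (hη : η ∈ D)
    (hη0 : η ≠ 0) (j : ℕ) :
    charApprox Λ T Φ D w η j = (Φ ^ (-((j : ℤ) + w))) ''
      ⋃ z ∈ (Φ ^ j) η +ᵥ intValues Φ D w (j + 1 - w), (z +ᵥ T) := by
  rw [charApprox, cellCoverAt, h.charSetLevel_eq hη hη0, image_zpow_image, add_neg_cancel,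
    cellCover]
  have h1 : ((Φ ^ (0 : ℤ)) '' ((Φ ^ j) η +ᵥ intValues Φ D w (j + 1 - w))) ∩ (Λ : Set E)
      = (Φ ^ j) η +ᵥ intValues Φ D w (j + 1 - w) := by
    rw [image_zpow_zero]
    refine inter_eq_left.2 ?_
    rintro _ ⟨z, hz, rfl⟩
    exact Λ.add_mem (h.pow_mem j (h.digits.subset hη)) (h.intValues_subset _ hz)
  rw [h1]

/-! ### Inclusion in the tile -/

lemma norm_charSet_sub_le [CompleteSpace E] (h : DigitSystem Λ Φ ρ T r R w D) {η : E} (hη : η ∈ D) (hη0 : η ≠ 0)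
    {x : E} (hx : x ∈ charSet Φ D w η) : ‖x - (Φ ^ (-(w : ℤ))) η‖ ≤ R / (ρ ^ w - 1) := by
  rw [h.charSet_eq hη hη0] at hx
  obtain ⟨y, hy, rfl⟩ := hx
  simpa using h.norm_valueSet_le hy

lemma norm_charApprox_sub_le [CompleteSpace E] (h : DigitSystem Λ Φ ρ T r R w D) {η : E} (hη : η ∈ D) (hη0 : η ≠ 0)
    {j : ℕ} {x : E} (hx : x ∈ charApprox Λ T Φ D w η j) :
    ‖x - (Φ ^ (-(w : ℤ))) η‖ ≤ R / (ρ ^ w - 1) := by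
  have hρ := h.one_lt
  have hρ0 := h.rho_pos
  have hR := h.R_pos
  have hpos := h.pow_sub_one_pos
  rw [h.charApprox_eq hη hη0] at hx
  obtain ⟨x, hx, rfl⟩ := hx
  obtain ⟨_, ⟨z, hz, rfl⟩, t, ht, rfl⟩ := mem_iUnion₂.1 hx
  have h1 : (Φ ^ (-((j : ℤ) + w))) ((Φ ^ j) η + z + t) - (Φ ^ (-(w : ℤ))) η
      = (Φ ^ (-((j : ℤ) + w))) (z + t) := by
    rw [add_assoc, map_add, ← zpow_natCast_apply, ← zpow_add_apply,
      show -((j : ℤ) + w) + j = -w by ring, add_sub_cancel_left]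
  change ‖(Φ ^ (-((j : ℤ) + w))) ((Φ ^ j) η + z + t) - (Φ ^ (-(w : ℤ))) η‖ ≤ _
  have h2 : ‖z + t‖ ≤ ‖z‖ + R := (norm_add_le _ _).trans (by linarith [h.norm_le_of_mem_tile ht])
  rw [h1, h.norm_zpow, zpow_neg, ← Nat.cast_add, zpow_natCast, inv_mul_le_iff₀ (by positivity)]
  refine h2.trans ?_
  rcases le_or_gt w (j + 1) with hj | hj
  · have h3 := h.norm_intValues_le _ z hz
    rw [show j + 1 - w + 2 * w - 1 = j + w by omega] at h3
    linarith
  · rw [show j + 1 - w = 0 by omega, h.intValues_zero] at hz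
    rw [mem_singleton_iff.1 hz, norm_zero, zero_add, mul_div_assoc', le_div_iff₀ hpos]
    have : ρ ^ w ≤ ρ ^ (j + w) := pow_le_pow_right₀ hρ.le (by omega)
    nlinarith

end DigitSystem

end WNAF

/-! ### Asymptotics of the counting recurrence. -/

namespace WNAF

/-! ### Linear recurrences with small characteristic roots -/

/-- The shift operator on sequences. -/
def shift : Module.End ℂ (ℕ → ℂ) := LinearMap.funLeft ℂ ℂ Nat.succ

lemma shift_pow_apply (i : ℕ) (e : ℕ → ℂ) (k : ℕ) : (shift ^ i) e k = e (k + i) := by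
  induction i generalizing e with
  | zero => rfl
  | succ i ih =>
    rw [pow_succ, Module.End.mul_apply, ih]
    rfl

lemma exists_bound_of_first_order {μ : ℝ} (hμ : 0 < μ) {α : ℂ} (hα : ‖α‖ < μ) {b : ℕ → ℂ} {C : ℝ}
    (hb : ∀ k, ‖b (k + 1) - α * b k‖ ≤ C * μ ^ k) : ∃ C', ∀ k, ‖b k‖ ≤ C' * μ ^ k := by
  have hC : 0 ≤ C := by simpa using (norm_nonneg _).trans (hb 0)
  have hd : 0 < μ - ‖α‖ := sub_pos.2 hα
  refine ⟨‖b 0‖ + C / (μ - ‖α‖), fun k => ?_⟩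
  induction k with
  | zero => simpa using div_nonneg hC hd.le
  | succ k ih =>
    have h1 : C ≤ (μ - ‖α‖) * (‖b 0‖ + C / (μ - ‖α‖)) := by
      rw [mul_add, mul_div_cancel₀ _ hd.ne']
      have := mul_nonneg hd.le (norm_nonneg (b 0))
      linarith
    calc ‖b (k + 1)‖ = ‖(b (k + 1) - α * b k) + α * b k‖ := by rw [sub_add_cancel]
      _ ≤ C * μ ^ k + ‖α‖ * ((‖b 0‖ + C / (μ - ‖α‖)) * μ ^ k) := by
        refine (norm_add_le _ _).trans (add_le_add (hb k) ?_)
        rw [norm_mul]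
        gcongr
      _ ≤ (μ - ‖α‖) * (‖b 0‖ + C / (μ - ‖α‖)) * μ ^ k
          + ‖α‖ * ((‖b 0‖ + C / (μ - ‖α‖)) * μ ^ k) := by gcongr
      _ = (‖b 0‖ + C / (μ - ‖α‖)) * μ ^ (k + 1) := by ring

open Polynomial in
-- Linear factors are removed one at a time by `exists_bound_of_first_order`. As `‖α‖ < μ` is
-- strict, repeated roots cost no polynomial factor.
lemma exists_bound_of_aeval_prod {μ : ℝ} (hμ : 0 < μ) (s : Multiset ℂ) (hs : ∀ α ∈ s, ‖α‖ < μ)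
    (e : ℕ → ℂ) {C : ℝ}
    (he : ∀ k, ‖(aeval shift (s.map fun α => X - Polynomial.C α).prod) e k‖ ≤ C * μ ^ k) :
    ∃ C', ∀ k, ‖e k‖ ≤ C' * μ ^ k := by
  induction s using Multiset.induction_on generalizing C with
  | empty => exact ⟨C, fun k => by simpa using he k⟩
  | cons α s ih =>
    have h1 : ∃ C', ∀ k,
        ‖(aeval shift (s.map fun α => X - Polynomial.C α).prod) e k‖ ≤ C' * μ ^ k := by
      refine exists_bound_of_first_order (C := C) hμ (hs α (Multiset.mem_cons_self α s))
        fun k => ?_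
      have h2 := he k
      rw [Multiset.map_cons, Multiset.prod_cons, map_mul, Module.End.mul_apply, map_sub, aeval_X,
        aeval_C] at h2
      exact h2
    obtain ⟨C', hC'⟩ := h1
    exact ih (fun β hβ => hs β (Multiset.mem_cons_of_mem hβ)) hC'

open Polynomial in
/-- A sequence annihilated by a polynomial in the shift decays like `μ ^ k` if all roots of the
polynomial are smaller than `μ`. -/
lemma exists_bound_of_recurrence {μ : ℝ} (hμ : 0 < μ) {P : ℂ[X]} (hP : P ≠ 0)
    (hroots : ∀ α, P.eval α = 0 → ‖α‖ < μ) {e : ℕ → ℂ} (he : aeval shift P e = 0) :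
    ∃ C, ∀ k, ‖e k‖ ≤ C * μ ^ k := by
  refine exists_bound_of_aeval_prod (C := 0) hμ P.roots
    (fun α hα => hroots α (isRoot_of_mem_roots hα)) e fun k => ?_
  rw [(IsAlgClosed.splits P).eq_prod_roots, map_mul, Module.End.mul_apply, aeval_C,
    Module.algebraMap_end_apply] at he
  have h1 := (smul_eq_zero.1 he).resolve_left (leadingCoeff_ne_zero.2 hP)
  rw [h1]
  simp

/-! ### The characteristic roots of the counting recurrence -/

/-- The left-hand side is a convex combination of `y` and `y ^ w`. -/
lemma one_le_norm_of_root {p : ℝ} (hp0 : 0 < p) (hp1 : p < 1) {w : ℕ} {y : ℂ}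
    (hy : p * y + (1 - p) * y ^ w = 1) : 1 ≤ ‖y‖ := by
  by_contra! h
  have h1 : ‖(p : ℂ) * y + (1 - p) * y ^ w‖ ≤ p * ‖y‖ + (1 - p) * ‖y‖ ^ w := by
    refine (norm_add_le _ _).trans (le_of_eq ?_)
    rw [norm_mul, norm_mul, norm_pow, ← Complex.ofReal_one, ← Complex.ofReal_sub,
      Complex.norm_of_nonneg hp0.le, Complex.norm_of_nonneg (by linarith)]
  rw [hy, norm_one] at h1
  have h2 : ‖y‖ ^ w ≤ 1 := pow_le_one₀ (norm_nonneg _) h.le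
  nlinarith

/-- The polar form of `eq_one_of_root`. -/
lemma polar_root_eq {p : ℝ} (hp0 : 0 < p) (hp1 : p ≤ 1 / 2) {w : ℕ} (hw : 2 ≤ w) {s θ : ℝ}
    (hs1 : 1 ≤ s) (hys : s ≤ 1 + p / (w : ℝ) ^ 3) (hθ : |θ| ≤ Real.pi)
    (hre : p * (s * Real.cos θ) + (1 - p) * (s ^ w * Real.cos (w * θ)) = 1)
    (him : p * (s * Real.sin θ) + (1 - p) * (s ^ w * Real.sin (w * θ)) = 0) : s = 1 ∧ θ = 0 := by
  have hw' : (2 : ℝ) ≤ w := by exact_mod_cast hw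
  have hw0 : (0 : ℝ) < w := by linarith
  -- Taking moduli in (1 - p) y^w = 1 - p y eliminates the angle wθ.
  have hsq : ((1 - p) * s ^ w) ^ 2 = 1 - 2 * p * s * Real.cos θ + (p * s) ^ 2 := by
    have e1 : (1 - p) * s ^ w * Real.cos (w * θ) = 1 - p * s * Real.cos θ := by linarith
    have e2 : (1 - p) * s ^ w * Real.sin (w * θ) = - (p * s * Real.sin θ) := by linarith
    calc ((1 - p) * s ^ w) ^ 2 = ((1 - p) * s ^ w * Real.cos (w * θ)) ^ 2
          + ((1 - p) * s ^ w * Real.sin (w * θ)) ^ 2 := by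
            linear_combination (-((1 - p) * s ^ w) ^ 2) * Real.sin_sq_add_cos_sq (w * θ)
      _ = _ := by
        rw [e1, e2]
        linear_combination (p * s) ^ 2 * Real.sin_sq_add_cos_sq θ
  -- the modulus barely exceeds one
  set δ := s - 1 with hδ
  have hδ0 : 0 ≤ δ := by linarith
  have hδ1 : δ * w ^ 3 ≤ p := by
    rw [← le_div_iff₀ (by positivity)]; linarith
  have hsδ : s = 1 + δ := by rw [hδ]; ring
  have hwδ : w * δ * w ^ 2 ≤ p := by linarith
  have ht : 2 * (w * δ) ≤ 1 / 4 := by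
    have : w * δ * 4 ≤ w * δ * w ^ 2 := by
      have : (4 : ℝ) ≤ w ^ 2 := by nlinarith only [hw']
      gcongr
    linarith
  -- With x = 2wδ ≤ 1/4 one has e^x ≤ 1 + x + x² ≤ 1 + 5x/4.
  have hexp : (s ^ w) ^ 2 ≤ 1 + 5 / 2 * (w * δ) := by
    have h1 : (s ^ w) ^ 2 ≤ Real.exp (2 * (w * δ)) := by
      rw [← pow_mul, mul_comm w 2, show 2 * (w * δ) = ((2 * w : ℕ) : ℝ) * δ by push_cast; ring,
        Real.exp_nat_mul]
      have : s ≤ Real.exp δ := by rw [hsδ, add_comm]; exact Real.add_one_le_exp δ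
      gcongr
    have hx0 : 0 ≤ 2 * (w * δ) := by positivity
    have h2 := Real.abs_exp_sub_one_sub_id_le (x := 2 * (w * δ))
      (by rw [abs_of_nonneg hx0]; linarith)
    have h3 := (abs_le.1 h2).2
    nlinarith only [h1, h3, ht, hx0]
  -- hence the argument is small
  have hcos1 := Real.cos_le_one θ
  have hcos : (1 - Real.cos θ) * w ^ 2 ≤ 5 / 4 := by
    have h1 : 2 * p * (1 - Real.cos θ) ≤ (1 - p) ^ 2 * (5 / 2 * (w * δ)) + 2 * p * (1 - p) * δ := by
      have h2 : ((1 - p) * s ^ w) ^ 2 ≤ (1 - p) ^ 2 * (1 + 5 / 2 * (w * δ)) := by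
        rw [mul_pow]; gcongr
      rw [hsq, hsδ] at h2
      have hid : 1 - 2 * p * (1 + δ) * Real.cos θ + (p * (1 + δ)) ^ 2 = (1 - p) ^ 2
          - 2 * p * (1 - p) * δ + (p * δ) ^ 2 + 2 * p * (1 - Real.cos θ)
          + 2 * p * δ * (1 - Real.cos θ) := by ring
      have h3 : 0 ≤ 2 * p * δ * (1 - Real.cos θ) := by
        have : 0 ≤ 1 - Real.cos θ := by linarith
        positivity
      linarith [sq_nonneg (p * δ), hid]
    have h4 : δ * w ^ 2 * 2 ≤ p := by
      have : δ * w ^ 2 * 2 ≤ δ * w ^ 2 * w := by gcongr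
      linarith
    have h5 : 2 * p * ((1 - Real.cos θ) * w ^ 2) ≤
        (1 - p) ^ 2 * (5 / 2) * p + p * (1 - p) * p := by
      calc 2 * p * ((1 - Real.cos θ) * w ^ 2) = (2 * p * (1 - Real.cos θ)) * w ^ 2 := by ring
        _ ≤ ((1 - p) ^ 2 * (5 / 2 * (w * δ)) + 2 * p * (1 - p) * δ) * w ^ 2 := by gcongr
        _ = (1 - p) ^ 2 * (5 / 2) * (w * δ * w ^ 2) + p * (1 - p) * (δ * w ^ 2 * 2) := by ring
        _ ≤ _ := by
          have : 0 ≤ 1 - p := by linarith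
          gcongr
    have h6 : (1 - p) ^ 2 * (5 / 2) + p * (1 - p) ≤ 5 / 2 := by nlinarith
    have h7 : p * (2 * ((1 - Real.cos θ) * w ^ 2)) ≤ p * (5 / 2) := by
      calc p * (2 * ((1 - Real.cos θ) * w ^ 2))
          ≤ p * ((1 - p) ^ 2 * (5 / 2) + p * (1 - p)) := by linarith
        _ ≤ _ := by gcongr
    linarith [le_of_mul_le_mul_left h7 hp0]
  have hpi := Real.pi_pos
  -- The bound cos θ ≤ 1 - 2θ²/π² turns `hcos` into (wθ)² ≤ 5π²/8.
  have hθπ : |w * θ| < Real.pi := by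
    have h1 := Real.cos_le_one_sub_mul_cos_sq (x := θ) hθ
    have h2 : 2 / Real.pi ^ 2 * (w * θ) ^ 2 ≤ 5 / 4 := by
      have : 2 / Real.pi ^ 2 * θ ^ 2 ≤ 1 - Real.cos θ := by linarith
      calc 2 / Real.pi ^ 2 * (w * θ) ^ 2 = (2 / Real.pi ^ 2 * θ ^ 2) * w ^ 2 := by ring
        _ ≤ (1 - Real.cos θ) * w ^ 2 := by gcongr
        _ ≤ _ := hcos
    refine abs_lt_of_sq_lt_sq ?_ hpi.le
    rw [div_mul_eq_mul_div, div_le_iff₀ (by positivity)] at h2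
    nlinarith only [h2, hpi]
  have hsw : 0 < s ^ w := by positivity
  have hs0 : 0 < s := by linarith
  have hp' : 0 < 1 - p := by linarith
  -- For θ ≠ 0 both sines now have the sign of θ, so the imaginary part cannot vanish.
  have hθ0 : θ = 0 := by
    rcases lt_trichotomy θ 0 with h | h | h
    · have h1 : Real.sin θ < 0 := Real.sin_neg_of_neg_of_neg_pi_lt h (by
        have := (abs_lt.1 hθπ).1; nlinarith only [this, h, hw'])
      have h2 : Real.sin (w * θ) < 0 :=
        Real.sin_neg_of_neg_of_neg_pi_lt (mul_neg_of_pos_of_neg hw0 h) (abs_lt.1 hθπ).1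
      have h3 : p * (s * Real.sin θ) < 0 := mul_neg_of_pos_of_neg hp0 (mul_neg_of_pos_of_neg hs0 h1)
      have h4 : (1 - p) * (s ^ w * Real.sin (w * θ)) < 0 :=
        mul_neg_of_pos_of_neg hp' (mul_neg_of_pos_of_neg hsw h2)
      linarith
    · exact h
    · have h1 : 0 < Real.sin θ := Real.sin_pos_of_pos_of_lt_pi h (by
        have := (abs_lt.1 hθπ).2; nlinarith only [this, h, hw'])
      have h2 : 0 < Real.sin (w * θ) :=
        Real.sin_pos_of_pos_of_lt_pi (mul_pos hw0 h) (abs_lt.1 hθπ).2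
      have h3 : 0 < p * (s * Real.sin θ) := by positivity
      have h4 : 0 < (1 - p) * (s ^ w * Real.sin (w * θ)) := by positivity
      linarith
  rw [hθ0, mul_zero, Real.cos_zero] at hre
  have hsw1 : 1 ≤ s ^ w := one_le_pow₀ hs1
  exact ⟨by nlinarith only [hre, hsw1, hs1, hp0, hp'], hθ0⟩

lemma eq_one_of_root {p : ℝ} (hp0 : 0 < p) (hp1 : p ≤ 1 / 2) {w : ℕ} (hw : 2 ≤ w) {y : ℂ}
    (hy : p * y + (1 - p) * y ^ w = 1) (hys : ‖y‖ ≤ 1 + p / (w : ℝ) ^ 3) : y = 1 := by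
  have hpow : y ^ w = ((‖y‖ ^ w * Real.cos (w * y.arg) : ℝ) : ℂ)
      + ((‖y‖ ^ w * Real.sin (w * y.arg) : ℝ) : ℂ) * Complex.I := by
    conv_lhs => rw [← Complex.norm_mul_cos_add_sin_mul_I y]
    rw [mul_pow, Complex.cos_add_sin_mul_I_pow]
    push_cast
    ring
  have hq : (1 - (p : ℂ)) = ((1 - p : ℝ) : ℂ) := by push_cast; rfl
  have hpre : (y ^ w).re = ‖y‖ ^ w * Real.cos (w * y.arg) := by
    rw [hpow, Complex.add_re, Complex.ofReal_re, Complex.re_ofReal_mul, Complex.I_re, mul_zero,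
      add_zero]
  have hpim : (y ^ w).im = ‖y‖ ^ w * Real.sin (w * y.arg) := by
    rw [hpow, Complex.add_im, Complex.ofReal_im, Complex.im_ofReal_mul, Complex.I_im, mul_one,
      zero_add]
  have hs1 := one_le_norm_of_root hp0 (by linarith) hy
  rw [hq] at hy
  obtain ⟨h1, h2⟩ := polar_root_eq hp0 hp1 hw hs1 hys
    (Complex.abs_arg_le_pi y) (by
      have := congrArg Complex.re hy
      rwa [Complex.add_re, Complex.re_ofReal_mul, Complex.re_ofReal_mul, hpre,
        ← Complex.norm_mul_cos_arg y, Complex.one_re] at this) (by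
      have := congrArg Complex.im hy
      rwa [Complex.add_im, Complex.im_ofReal_mul, Complex.im_ofReal_mul, hpim,
        ← Complex.norm_mul_sin_arg y, Complex.one_im] at this)
  rw [← Complex.norm_mul_cos_add_sin_mul_I y, h1, h2]
  simp

open Polynomial in
/-- The characteristic polynomial of the counting recurrence, with the root `1` removed. -/
def charPoly (p : ℝ) (v : ℕ) : ℂ[X] := X ^ v + C (1 - p : ℂ) * ∑ i ∈ Finset.range v, X ^ i

lemma charPoly_eval (p : ℝ) (v : ℕ) (x : ℂ) :
    (charPoly p v).eval x = x ^ v + (1 - p) * ∑ i ∈ Finset.range v, x ^ i := by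
  simp [charPoly, Polynomial.eval_finsetSum]

lemma charPoly_eval_one_ne_zero {p : ℝ} (hp1 : p ≤ 1 / 2) (v : ℕ) : (charPoly p v).eval 1 ≠ 0 := by
  rw [charPoly_eval]
  simp only [one_pow, Finset.sum_const, Finset.card_range, nsmul_eq_mul, mul_one]
  have h1 : (0 : ℝ) < 1 + (1 - p) * v := by
    have : 0 ≤ (1 - p) * v := mul_nonneg (by linarith) (Nat.cast_nonneg v)
    linarith
  exact_mod_cast h1.ne'

/-- Since (X - 1) · `charPoly p v` = X^(v+1) - p X^v - (1 - p), the reciprocal of a non-zero root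
solves the equation of `eq_one_of_root` with w = v + 1. For v = 0 the polynomial is the constant 1.
-/
lemma norm_root_charPoly_lt {p : ℝ} (hp0 : 0 < p) (hp1 : p ≤ 1 / 2) (v : ℕ) {x : ℂ}
    (hx : (charPoly p v).eval x = 0) : ‖x‖ < (1 + p / ((v + 1 : ℕ) : ℝ) ^ 3)⁻¹ := by
  have hμ : (0 : ℝ) < 1 + p / ((v + 1 : ℕ) : ℝ) ^ 3 := by positivity
  rcases Nat.eq_zero_or_pos v with rfl | hv
  · simp [charPoly] at hx
  by_contra! hc
  have hx0 : 0 < ‖x‖ := (inv_pos.2 hμ).trans_le hc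
  have hx0' : x ≠ 0 := norm_pos_iff.1 hx0
  have hx1 : x ≠ 1 := by
    rintro rfl
    exact charPoly_eval_one_ne_zero hp1 v hx
  have h1 : x ^ (v + 1) = p * x ^ v + (1 - p) := by
    have h2 := geom_sum_mul x v
    rw [charPoly_eval] at hx
    linear_combination (x - 1) * hx - (1 - p : ℂ) * h2
  refine hx1 (inv_eq_one.1 (eq_one_of_root (w := v + 1) hp0 hp1 (by omega) ?_ ?_))
  · have hxp : x ^ (v + 1) ≠ 0 := pow_ne_zero _ hx0'
    rw [inv_pow, ← mul_left_inj' hxp, add_mul, mul_assoc (1 - p : ℂ), inv_mul_cancel₀ hxp, one_mul,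
      h1, ← h1, pow_succ]
    field_simp
    linear_combination (-1 : ℂ) * h1
  · rw [norm_inv]
    exact inv_le_of_inv_le₀ hμ hc

/-! ### The counting recurrence -/

lemma exists_bound_of_counting_recurrence {q : ℝ} (hq : 2 ≤ q) (v : ℕ) {N : ℕ → ℝ} (h0 : N 0 = 1)
    (hN : ∀ m, N (m + 1) = N m + q ^ v * (q - 1) * N (m - v)) :
    ∃ C, ∀ k, |N (k - v) * q ^ v / q ^ k - q ^ (v + 1) / ((q - 1) * (v + 1 : ℕ) + 1)| ≤
      C * (1 + q⁻¹ / ((v + 1 : ℕ) : ℝ) ^ 3)⁻¹ ^ k := by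
  have hq0 : 0 < q := by linarith
  have hp0 : 0 < q⁻¹ := inv_pos.2 hq0
  have hp1 : q⁻¹ ≤ 1 / 2 := by
    rw [one_div]; exact inv_anti₀ (by norm_num) hq
  -- Division by q^k moves the dominant root to 1. For k ≤ v the truncated `k - v` gives `N 0 = 1`,
  -- so the initial values are q^(v-k).
  set a : ℕ → ℝ := fun k => N (k - v) * q ^ v / q ^ k with ha
  set L : ℝ := q ^ (v + 1) / ((q - 1) * (v + 1 : ℕ) + 1) with hL
  have hrec : ∀ k, a (k + v + 1) = q⁻¹ * a (k + v) + (1 - q⁻¹) * a k := fun k => by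
    simp only [ha]
    rw [show k + v + 1 - v = k + 1 by omega, show k + v - v = k by omega, hN]
    field_simp
    ring
  -- The root 1 corresponds to a conserved linear form. The constant sequence `L` has the same value
  -- under it, so `a - L` is annihilated by `charPoly`.
  have hinv : ∀ k, a (k + v) + (1 - q⁻¹) * ∑ i ∈ Finset.range v, a (k + i) = q ^ v := fun k => by
    induction k with
    | zero =>
      have h1 : ∑ i ∈ Finset.range v, a (0 + i) = ∑ i ∈ Finset.range v, q ^ (i + 1) := by
        rw [← Finset.sum_range_reflect]
        refine Finset.sum_congr rfl fun i hi => ?_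
        have hi := Finset.mem_range.1 hi
        simp only [ha]
        rw [show 0 + (v - 1 - i) - v = 0 by omega, h0, one_mul, div_eq_iff (by positivity),
          ← pow_add]
        congr 1; omega
      have h2 : a (0 + v) = 1 := by
        simp only [ha]
        rw [zero_add, Nat.sub_self, h0, one_mul, div_self (by positivity)]
      rw [h1, h2]
      have h3 := geom_sum_mul q v
      simp only [pow_succ, ← Finset.sum_mul]
      field_simp
      linarith
    | succ k ih =>
      have h1 : ∑ i ∈ Finset.range v, a (k + 1 + i) + a k
          = ∑ i ∈ Finset.range v, a (k + i) + a (k + v) := by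
        rw [← Finset.sum_range_succ, Finset.sum_range_succ']
        congr 1
        exact Finset.sum_congr rfl fun i _ => by congr 1; omega
      rw [show k + 1 + v = k + v + 1 by omega, hrec]
      linear_combination ih + (1 - q⁻¹) * h1
  have hden : 0 < (q - 1) * (v + 1 : ℕ) + 1 := by
    have : 0 ≤ (q - 1) * (v + 1 : ℕ) := mul_nonneg (by linarith) (Nat.cast_nonneg _)
    linarith
  have hLeq : L * (1 + (1 - q⁻¹) * v) = q ^ v := by
    rw [hL, div_mul_eq_mul_div, div_eq_iff hden.ne', pow_succ]
    push_cast
    field_simp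
    ring
  have hann : Polynomial.aeval shift (charPoly q⁻¹ v) (fun k => ((a k - L : ℝ) : ℂ)) = 0 := by
    funext k
    simp only [charPoly, map_add, map_mul, map_sum, map_pow, Polynomial.aeval_X,
      Polynomial.aeval_C, LinearMap.add_apply, Module.End.mul_apply, Module.algebraMap_end_apply,
      LinearMap.sum_apply, Pi.add_apply, Pi.smul_apply, Finset.sum_apply, shift_pow_apply,
      Pi.zero_apply, smul_eq_mul]
    have h1 : (a (k + v) - L) + (1 - q⁻¹) * ∑ i ∈ Finset.range v, (a (k + i) - L) = 0 := by
      rw [Finset.sum_sub_distrib, Finset.sum_const, Finset.card_range, nsmul_eq_mul]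
      linear_combination hinv k - hLeq
    rw [Finset.mul_sum] at h1
    exact_mod_cast congrArg (fun x : ℝ => (x : ℂ)) h1
  obtain ⟨C, hC⟩ := exists_bound_of_recurrence (μ := (1 + q⁻¹ / ((v + 1 : ℕ) : ℝ) ^ 3)⁻¹)
    (by positivity) (P := charPoly q⁻¹ v)
    (fun h => charPoly_eval_one_ne_zero hp1 v (by rw [h, Polynomial.eval_zero]))
    (fun α hα => norm_root_charPoly_lt hp0 hp1 v hα) hann
  refine ⟨C, fun k => ?_⟩
  have := hC k
  rwa [Complex.norm_real, Real.norm_eq_abs] at this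

end WNAF

/-! ### Volume factor of Φ, tiles, and measure under fractional parts. -/

namespace WNAF

variable {E : Type*} [NormedAddCommGroup E] [NormedSpace ℝ E]
variable {Φ : E ≃L[ℝ] E} {ρ : ℝ} {D : Set E} {w : ℕ}

/-! ### Scaling of volumes -/

/-- Up to sign, the determinant is the constant coefficient of the characteristic polynomial, that
is, the product of the complex roots. -/
lemma abs_det_eq_pow [FiniteDimensional ℝ E] (Φ : E →ₗ[ℝ] E)
    (hΦ : ∀ z ∈ Φ.charpoly.aroots ℂ, ‖z‖ = ρ) : |LinearMap.det Φ| = ρ ^ Module.finrank ℝ E := by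
  have hmonic : (Φ.charpoly.map (algebraMap ℝ ℂ)).Monic := Φ.charpoly_monic.map _
  have hsplits := IsAlgClosed.splits (Φ.charpoly.map (algebraMap ℝ ℂ))
  have h1 := hsplits.coeff_zero_eq_prod_roots_of_monic hmonic
  have h2 : ‖(Φ.charpoly.map (algebraMap ℝ ℂ)).roots.prod‖
      = ρ ^ Multiset.card (Φ.charpoly.map (algebraMap ℝ ℂ)).roots := by
    have h3 : ∀ s : Multiset ℂ, (∀ z ∈ s, ‖z‖ = ρ) → ‖s.prod‖ = ρ ^ Multiset.card s := by
      intro s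
      induction s using Multiset.induction_on with
      | empty => simp
      | cons a s ih =>
        intro hs
        rw [Multiset.prod_cons, norm_mul, hs a (Multiset.mem_cons_self a s),
          ih fun z hz => hs z (Multiset.mem_cons_of_mem hz), Multiset.card_cons, pow_succ, mul_comm]
    exact h3 _ hΦ
  rw [← hsplits.natDegree_eq_card_roots, Polynomial.natDegree_map, LinearMap.charpoly_natDegree]
    at h2
  rw [LinearMap.det_eq_sign_charpoly_coeff, abs_mul, abs_pow, abs_neg, abs_one, one_pow, one_mul,
    ← h2, ← Real.norm_eq_abs, ← Complex.norm_real]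
  rw [Polynomial.coeff_map] at h1
  change ‖algebraMap ℝ ℂ (Φ.charpoly.coeff 0)‖ = _
  rw [h1, norm_mul, norm_pow, norm_neg, norm_one, one_pow, one_mul]

/-! ### Fractional parts -/

section FracPart

variable {Λ : Submodule ℤ E}

lemma fracPart_mem {T' : Set E} (hT' : IsExactTiling Λ T') (x : E) : fracPart hT' x ∈ T' :=
  (hT' x).choose_spec.1.1

lemma sub_fracPart_mem {T' : Set E} (hT' : IsExactTiling Λ T') (x : E) :
    x - fracPart hT' x ∈ Λ :=
  (hT' x).choose_spec.1.2

lemma eq_fracPart {T' : Set E} (hT' : IsExactTiling Λ T') {x v : E} (hv : v ∈ T')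
    (hxv : x - v ∈ Λ) : v = fracPart hT' x :=
  (hT' x).choose_spec.2 v ⟨hv, hxv⟩

lemma image_fracPart_subset {T' : Set E} (hT' : IsExactTiling Λ T') (B : Set E) :
    fracPart hT' '' B ⊆ T' := by
  rintro _ ⟨x, -, rfl⟩
  exact fracPart_mem hT' x

lemma image_fracPart_eq {T' : Set E} (hT' : IsExactTiling Λ T') (B : Set E) :
    fracPart hT' '' B = ⋃ g : Λ, (g +ᵥ B) ∩ T' := by
  ext v
  simp only [mem_image, mem_iUnion, mem_inter_iff, mem_vadd_set]
  constructor
  · rintro ⟨x, hx, rfl⟩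
    refine ⟨-⟨_, sub_fracPart_mem hT' x⟩, ⟨x, hx, ?_⟩, fracPart_mem hT' x⟩
    rw [Submodule.vadd_def, vadd_eq_add, Submodule.coe_neg, neg_sub, sub_add_cancel]
  · rintro ⟨g, ⟨x, hx, rfl⟩, hv⟩
    refine ⟨x, hx, (eq_fracPart hT' hv ?_).symm⟩
    rw [Submodule.vadd_def, vadd_eq_add, sub_add_cancel_right]
    exact Λ.neg_mem g.2

end FracPart

section Measure

variable [MeasurableSpace E] [BorelSpace E] [FiniteDimensional ℝ E] {vol : Measure E}
  [vol.IsAddHaarMeasure] {q : ℝ}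

lemma measure_image_zpow (hq : 0 < q) (hvol : ∀ s, vol (Φ '' s) = ENNReal.ofReal q * vol s) (k : ℤ)
    (s : Set E) : vol ((Φ ^ k) '' s) = ENNReal.ofReal (q ^ k) * vol s := by
  induction k using Int.induction_on generalizing s with
  | zero => rw [image_zpow_zero, zpow_zero, ENNReal.ofReal_one, one_mul]
  | succ i ih =>
    rw [← image_zpow_image, ih, zpow_one, hvol, ← mul_assoc, ← ENNReal.ofReal_mul (by positivity),
      zpow_add₀ hq.ne', zpow_one]
  | pred i ih =>
    have h1 : vol (Φ '' ((Φ ^ (-(i : ℤ) - 1)) '' s)) = vol ((Φ ^ (-(i : ℤ))) '' s) := by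
      conv_lhs => enter [2, 1]; rw [← zpow_one Φ]
      rw [image_zpow_image, add_sub_cancel]
    rw [hvol, ih] at h1
    have h2 : ENNReal.ofReal q⁻¹ * ENNReal.ofReal q = 1 := by
      rw [← ENNReal.ofReal_mul (by positivity), inv_mul_cancel₀ hq.ne', ENNReal.ofReal_one]
    calc vol ((Φ ^ (-(i : ℤ) - 1)) '' s)
        = ENNReal.ofReal q⁻¹ * (ENNReal.ofReal q * vol ((Φ ^ (-(i : ℤ) - 1)) '' s)) := by
          rw [← mul_assoc, h2, one_mul]
      _ = _ := by
        rw [h1, ← mul_assoc, ← ENNReal.ofReal_mul (by positivity), zpow_sub₀ hq.ne', zpow_one,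
          div_eq_inv_mul]

lemma measureReal_image_zpow (hq : 0 < q) (hvol : ∀ s, vol (Φ '' s) = ENNReal.ofReal q * vol s)
    (k : ℤ) (s : Set E) : vol.real ((Φ ^ k) '' s) = q ^ k * vol.real s := by
  rw [measureReal_def, measure_image_zpow hq hvol, ENNReal.toReal_mul,
    ENNReal.toReal_ofReal (by positivity), measureReal_def]

lemma measureReal_vadd (x : E) (s : Set E) : vol.real (x +ᵥ s) = vol.real s := by
  rw [measureReal_def, measure_vadd, measureReal_def]

namespace DigitSystem

variable {Λ : Submodule ℤ E} {T : Set E} {r R : ℝ}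

lemma isBounded_tile (h : DigitSystem Λ Φ ρ T r R w D) : Bornology.IsBounded T :=
  Metric.isBounded_closedBall.subset h.subset_closedBall

/-! ### Measure of the approximations -/

lemma aedisjoint_vadd_tile (hT : IsTiling vol Λ T) {z z' : E} (hz : z ∈ Λ) (hz' : z' ∈ Λ)
    (hne : z ≠ z') : AEDisjoint vol (z +ᵥ T) (z' +ᵥ T) := by
  have h1 : (z +ᵥ T) ∩ (z' +ᵥ T) = z +ᵥ (T ∩ ((z' - z) +ᵥ T)) := by
    rw [vadd_set_inter, vadd_vadd, add_sub_cancel]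
  rw [AEDisjoint, h1, measure_vadd]
  exact measure_mono_null (hT.inter_subset _ (Λ.sub_mem hz' hz) (sub_ne_zero.2 hne.symm))
    hT.frontier_null

lemma isCompact_tile (h : DigitSystem Λ Φ ρ T r R w D) (hT : IsTiling vol Λ T) : IsCompact T :=
  Metric.isCompact_of_isClosed_isBounded hT.isClosed h.isBounded_tile

lemma isClosed_charApprox (h : DigitSystem Λ Φ ρ T r R w D) (hT : IsTiling vol Λ T) {η : E}
    (hη : η ∈ D) (hη0 : η ≠ 0) (j : ℕ) : IsClosed (charApprox Λ T Φ D w η j) := by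
  rw [h.charApprox_eq hη hη0]
  refine (Φ ^ (-((j : ℤ) + w))).toHomeomorph.isClosedMap _ ?_
  refine Set.Finite.isClosed_biUnion ((h.finite_intValues _).image _) fun z _ => ?_
  exact hT.isClosed.vadd z

lemma measureReal_charApprox (h : DigitSystem Λ Φ ρ T r R w D) (hT : IsTiling vol Λ T)
    (hq : 0 < q) (hvol : ∀ s, vol (Φ '' s) = ENNReal.ofReal q * vol s) {η : E} (hη : η ∈ D)
    (hη0 : η ≠ 0) (j : ℕ) :
    vol.real (charApprox Λ T Φ D w η j)
      = (intValues Φ D w (j + 1 - w)).ncard / q ^ (j + w) * vol.real T := by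
  have hfin : ((Φ ^ j) η +ᵥ intValues Φ D w (j + 1 - w)).Finite :=
    (h.finite_intValues _).image _
  have hsub : ∀ z ∈ hfin.toFinset, z ∈ Λ := by
    intro z hz
    obtain ⟨y, hy, rfl⟩ := hfin.mem_toFinset.1 hz
    exact Λ.add_mem (h.pow_mem j (h.digits.subset hη)) (h.intValues_subset _ hy)
  have h1 : ⋃ z ∈ (Φ ^ j) η +ᵥ intValues Φ D w (j + 1 - w), (z +ᵥ T)
      = ⋃ z ∈ hfin.toFinset, (z +ᵥ T) := by
    simp only [hfin.mem_toFinset]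
  rw [h.charApprox_eq hη hη0, measureReal_image_zpow hq hvol, h1,
    measureReal_biUnion_finset₀ ?_ ?_ fun z _ => ?_]
  · simp only [measureReal_vadd, Finset.sum_const, nsmul_eq_mul]
    rw [← ncard_eq_toFinset_card _ hfin]
    have h2 : ((Φ ^ j) η +ᵥ intValues Φ D w (j + 1 - w)).ncard
        = (intValues Φ D w (j + 1 - w)).ncard :=
      ncard_image_of_injective _ (add_right_injective _)
    rw [h2, zpow_neg, ← Nat.cast_add, zpow_natCast]
    ring
  · exact fun z hz z' hz' hne => aedisjoint_vadd_tile hT (hsub z hz) (hsub z' hz') hne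
  · exact fun z _ => (hT.isClosed.vadd z).measurableSet.nullMeasurableSet
  · rw [measure_vadd]
    exact (h.isCompact_tile hT).measure_ne_top

/-! ### Measure of fractional parts -/

/-- `T'` lies between the interior of `T` and `T`, which differ by a null set: an interior point
lies in no other translate, so it must be its own representative. -/
lemma nullMeasurableSet_exactTile (hT : IsTiling vol Λ T) {T' : Set E} (hT'T : T' ⊆ T)
    (hT' : IsExactTiling Λ T') : NullMeasurableSet T' vol := by
  have hintT : interior T ⊆ T' := by
    intro x hx
    obtain ⟨v, ⟨hv, hxv⟩, -⟩ := hT' x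
    by_cases h0 : x - v = 0
    · rwa [sub_eq_zero.1 h0]
    · have h1 : x ∈ frontier T := hT.inter_subset _ hxv h0
        ⟨interior_subset hx, mem_vadd_set.2 ⟨v, hT'T hv, by simp⟩⟩
      exact absurd hx h1.2
  have h1 : T' =ᵐ[vol] T := by
    refine (LE.le.eventuallyLE hT'T).antisymm ?_
    rw [ae_le_set]
    refine measure_mono_null (fun x hx => ?_) hT.frontier_null
    exact ⟨subset_closure hx.1, fun h => hx.2 (hintT h)⟩
  exact hT.isClosed.measurableSet.nullMeasurableSet.congr h1.symm

lemma isAddFundamentalDomain (hT : IsTiling vol Λ T) {T' : Set E} (hT'T : T' ⊆ T)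
    (hT' : IsExactTiling Λ T') : IsAddFundamentalDomain Λ T' vol := by
  refine IsAddFundamentalDomain.mk' (nullMeasurableSet_exactTile hT hT'T hT') fun x => ?_
  refine ⟨-⟨_, sub_fracPart_mem hT' x⟩, ?_, fun g hg => ?_⟩
  · have : (-(⟨_, sub_fracPart_mem hT' x⟩ : Λ)) +ᵥ x = fracPart hT' x := by
      rw [Submodule.vadd_def, vadd_eq_add, Submodule.coe_neg, neg_sub, sub_add_cancel]
    simp only [this]
    exact fracPart_mem hT' x
  · have h1 := eq_fracPart hT' (x := x) hg (by
      rw [Submodule.vadd_def, vadd_eq_add, sub_add_cancel_right]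
      exact Λ.neg_mem g.2)
    apply Subtype.ext
    rw [Submodule.coe_neg]
    simp only [← h1, Submodule.vadd_def, vadd_eq_add]
    abel

/-- Taking fractional parts preserves the measure of a set inside a ball of radius `r`. -/
lemma measure_image_fracPart [DiscreteTopology Λ] [IsZLattice ℝ Λ]
    (h : DigitSystem Λ Φ ρ T r R w D) (hT : IsTiling vol Λ T) {T' : Set E} (hT'T : T' ⊆ T)
    (hT' : IsExactTiling Λ T') {B : Set E} (hB : MeasurableSet B) {c : E}
    (hBc : ∀ x ∈ B, ‖x - c‖ < r) :
    NullMeasurableSet (fracPart hT' '' B) vol ∧ vol B = vol (fracPart hT' '' B) := by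
  have hnull : ∀ g : Λ, NullMeasurableSet ((g +ᵥ B) ∩ T') vol := fun g =>
    (hB.const_vadd (g : E)).nullMeasurableSet.inter (nullMeasurableSet_exactTile hT hT'T hT')
  have : VAddInvariantMeasure Λ E vol :=
    ⟨fun g s _ => measure_preimage_add vol (g : E) s⟩
  rw [image_fracPart_eq]
  refine ⟨NullMeasurableSet.iUnion hnull, ?_⟩
  rw [measure_iUnion₀ ?_ hnull, (isAddFundamentalDomain hT hT'T hT').measure_eq_tsum B]
  -- If two translates of `B` meet, two points of `B` differ by `g' - g`. Relative to `c` both lie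
  -- in the ball of radius `r`, so this difference is 0.
  intro g g' hne
  refine Disjoint.aedisjoint (Set.disjoint_left.2 ?_)
  rintro y ⟨⟨x, hx, hxy⟩, -⟩ ⟨⟨x', hx', hxy'⟩, -⟩
  refine hne ?_
  have h1 : (g' : E) - g = x - x' := by
    simp only [vadd_eq_add] at hxy hxy'
    rw [sub_eq_sub_iff_add_eq_add, hxy', add_comm, hxy]
  have h2 := h.eq_zero_of_mem_tile (p := x - c) (u := x - x')
    (interior_subset (h.mem_interior_tile (hBc x hx))) (h1 ▸ Λ.sub_mem g'.2 g.2)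
    (by rw [sub_sub_sub_cancel_left]; exact hBc x' hx')
  rw [h2] at h1
  exact Subtype.ext (sub_eq_zero.1 h1).symm

end DigitSystem

end Measure

end WNAF

/-! ### Cells of integer expansions and their essential disjointness. -/

namespace WNAF

variable {E : Type*} [NormedAddCommGroup E] [NormedSpace ℝ E]
variable {Φ : E ≃L[ℝ] E} {ρ : ℝ} {D : Set E} {w : ℕ}

/-! ### Essential disjointness from an equality of measures -/

/-- Equality in subadditivity leaves no mass for any pairwise intersection. -/
lemma aedisjoint_of_sum_le {α ι : Type*} [MeasurableSpace α] {μ : Measure α} {s : Finset ι}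
    {f : ι → Set α} (hm : ∀ i ∈ s, MeasurableSet (f i)) (hf : ∀ i ∈ s, μ (f i) ≠ ∞)
    (hsum : ∑ i ∈ s, μ.real (f i) ≤ μ.real (⋃ i ∈ s, f i)) {i j : ι} (hi : i ∈ s) (hj : j ∈ s)
    (hij : i ≠ j) : AEDisjoint μ (f i) (f j) := by
  classical
  have hj' : j ∈ s.erase i := Finset.mem_erase.2 ⟨hij.symm, hj⟩
  have h1 : μ.real (⋃ k ∈ s, f k) ≤
      μ.real (f i ∪ f j) + ∑ k ∈ (s.erase i).erase j, μ.real (f k) := by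
    refine (measureReal_mono (s₂ := (f i ∪ f j) ∪ ⋃ k ∈ (s.erase i).erase j, f k) ?_ ?_).trans
      ((measureReal_union_le _ _).trans (add_le_add le_rfl (measureReal_biUnion_finset_le _ _)))
    · refine iUnion₂_subset fun k hk => ?_
      by_cases hki : k = i
      · subst hki; exact subset_union_left.trans subset_union_left
      by_cases hkj : k = j
      · subst hkj; exact subset_union_right.trans subset_union_left
      exact (subset_biUnion_of_mem (u := f)
        (Finset.mem_erase.2 ⟨hkj, Finset.mem_erase.2 ⟨hki, hk⟩⟩)).trans subset_union_right
    · refine (measure_union_lt_top (measure_union_lt_top (hf i hi).lt_top (hf j hj).lt_top)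
        (measure_biUnion_lt_top (Finset.finite_toSet _) fun k hk => ?_)).ne
      exact (hf k (Finset.mem_of_mem_erase (Finset.mem_of_mem_erase hk))).lt_top
  have h2 := measureReal_union_add_inter (μ := μ) (s := f i) (t := f j) (hm j hj) (hf i hi)
    (hf j hj)
  have h3 := Finset.add_sum_erase s (fun k => μ.real (f k)) hi
  have h4 := Finset.add_sum_erase (s.erase i) (fun k => μ.real (f k)) hj'
  have h5 : μ.real (f i ∩ f j) = 0 :=
    le_antisymm (by linarith) measureReal_nonneg
  have h6 : μ (f i ∩ f j) ≠ ∞ := measure_ne_top_of_subset inter_subset_left (hf i hi)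
  exact (measureReal_eq_zero_iff h6).1 h5

/-! ### The tree of integer expansions -/

/-- `Node Φ D w m z k`: the integer `z` has a non-adjacent form with `m` digits, and `k` further
zeros have to follow before the next non-zero digit. -/
inductive Node (Φ : E ≃L[ℝ] E) (D : Set E) (w : ℕ) : ℕ → E → ℕ → Prop
  | root : Node Φ D w 0 0 0
  | zero {m : ℕ} {z : E} {k : ℕ} : Node Φ D w m z k → Node Φ D w (m + 1) (Φ z) (k - 1)
  | digit {m : ℕ} {z η : E} : Node Φ D w m z 0 → η ∈ D → η ≠ 0 →
      Node Φ D w (m + 1) (Φ z + η) (w - 1)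

/-- All values of the non-adjacent forms with integer part `z` and at least `k` zeros after
that. -/
def cell (Φ : E ≃L[ℝ] E) (D : Set E) (w : ℕ) (z : E) (k : ℕ) : Set E :=
  z +ᵥ valueSet Φ D w (Iio (-(k : ℤ)))

/-- A leading zero is prepended at the root, which allows finitely many nodes to be compared at one
level. -/
lemma Node.succ {m : ℕ} {z : E} {k : ℕ} (h : Node Φ D w m z k) : Node Φ D w (m + 1) z k := by
  induction h with
  | root => simpa using Node.zero (Φ := Φ) (D := D) (w := w) Node.root
  | zero _ ih => exact ih.zero
  | digit _ hη hη0 ih => exact ih.digit hη hη0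

lemma Node.mono {m m' : ℕ} (hm : m ≤ m') {z : E} {k : ℕ} (h : Node Φ D w m z k) :
    Node Φ D w m' z k := by
  induction hm with
  | refl => exact h
  | step _ ih => exact ih.succ

lemma Node.zero_pow {m : ℕ} {z : E} {k : ℕ} (h : Node Φ D w m z k) (i : ℕ) :
    Node Φ D w (m + i) ((Φ ^ i) z) (k - i) := by
  induction i with
  | zero => exact h
  | succ i ih =>
    have := ih.zero
    rw [pow_succ']
    exact this

lemma image_cell (Φ : E ≃L[ℝ] E) (D : Set E) (w : ℕ) (z : E) (k : ℕ) :
    Φ '' cell Φ D w z k = Φ z +ᵥ valueSet Φ D w (Iio (1 - (k : ℤ))) := by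
  rw [cell, image_clm_vadd]
  congr 1
  conv_lhs => enter [1]; rw [← zpow_one Φ]
  exact image_zpow_valueSet Φ fun i => by simp only [mem_Iio]; omega

namespace DigitSystem

variable {Λ : Submodule ℤ E} {T : Set E} {r R : ℝ}

lemma valueSet_Iio_one [CompleteSpace E] (h : DigitSystem Λ Φ ρ T r R w D) :
    valueSet Φ D w (Iio 1) = cell Φ D w 0 0 ∪ ⋃ η ∈ D \ {0}, cell Φ D w η (w - 1) := by
  have hw := h.width_pos
  rw [h.valueSet_split_top (I := Iio 1) (b := 0) (by simp) (by simp)]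
  have h1 : Iio (1 : ℤ) ∩ Iio 0 = Iio (-((0 : ℕ) : ℤ)) := by
    ext i; simp only [mem_inter_iff, mem_Iio]; omega
  have h2 : Iio (1 : ℤ) ∩ Iio (0 - (w : ℤ) + 1) = Iio (-((w - 1 : ℕ) : ℤ)) := by
    ext i; simp only [mem_inter_iff, mem_Iio]; omega
  simp only [cell, zero_vadd, h1, h2, zpow_zero_apply]

lemma cell_zero_subset (z : E) (k : ℕ) :
    cell Φ D w (Φ z) (k - 1) ⊆ Φ '' cell Φ D w z k := by
  rw [image_cell, cell]
  refine vadd_set_mono (valueSet_mono fun i hi => ?_)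
  simp only [mem_Iio] at *; omega

lemma cell_digit_subset [CompleteSpace E] (h : DigitSystem Λ Φ ρ T r R w D) (z : E) {η : E}
    (hη : η ∈ D) (hη0 : η ≠ 0) : cell Φ D w (Φ z + η) (w - 1) ⊆ Φ '' cell Φ D w z 0 := by
  have h1 : cell Φ D w (Φ z + η) (w - 1) = Φ z +ᵥ cell Φ D w η (w - 1) := by
    rw [cell, cell, vadd_vadd]
  rw [image_cell, h1, Nat.cast_zero, sub_zero, h.valueSet_Iio_one]
  exact vadd_set_mono (subset_union_of_subset_right
    (subset_biUnion_of_mem (u := fun η => cell Φ D w η (w - 1)) (⟨hη, hη0⟩ : η ∈ D \ {0})) _)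

/-- Dividing a lattice point by the base, with an expansion factor for the norm. -/
lemma exists_quotient (h : DigitSystem Λ Φ ρ T r R w D) :
    ∃ c : ℝ, 1 < c ∧ ∀ z ∈ Λ, ∃ z₁ ∈ Λ, c * ‖z₁‖ ≤ ‖z‖ ∧
      (z = Φ z₁ ∨ z ∉ Φ '' (Λ : Set E) ∧ ∃ d ∈ D, d ≠ 0 ∧ z = (Φ ^ w) z₁ + d) := by
  have hw := h.width_pos
  have hr := h.r_pos
  have hR := h.R_pos
  have hρ0 := h.rho_pos
  have h1R : 0 < 1 + R / r := by positivity
  -- The two entries handle `z` divisible and not divisible by Φ; the second exceeds 1 exactly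
  -- because R/r < ρ^w - 1.
  refine ⟨min ρ (ρ ^ w / (1 + R / r)), lt_min h.one_lt ?_, fun z hz => ?_⟩
  · rw [one_lt_div h1R]
    linarith [h.ratio_lt]
  by_cases hzΦ : z ∈ Φ '' (Λ : Set E)
  · obtain ⟨z₁, hz₁, rfl⟩ := hzΦ
    refine ⟨z₁, hz₁, ?_, Or.inl rfl⟩
    rw [h.norm_map]
    gcongr
    exact min_le_left _ _
  · obtain ⟨d, ⟨hd, z₁, hz₁, hzd⟩, -⟩ := h.digits.existsUnique z hz hzΦ
    have hd0 : d ≠ 0 := by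
      rintro rfl
      refine hzΦ ⟨(Φ ^ (w - 1)) z₁, h.pow_mem _ hz₁, ?_⟩
      rw [sub_zero] at hzd
      rw [← hzd]
      conv_rhs => rw [show w = 1 + (w - 1) by omega, pow_add, pow_one]
      rfl
    refine ⟨z₁, hz₁, ?_, Or.inr ⟨hzΦ, d, hd, hd0, by rw [hzd, sub_add_cancel]⟩⟩
    -- A short `z` forces the quotient 0 by the tile property; for a long `z` the digit has norm at
    -- most ‖z‖ R/r.
    rcases lt_or_ge ‖z‖ (ρ ^ w * r) with hlt | hge
    · obtain ⟨t, ht, rfl⟩ := h.digit_mem hd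
      have h1 : (Φ ^ w) (z₁ + t) = z := by rw [map_add, hzd, sub_add_cancel]
      have h2 : ‖z₁ + t‖ < r := by
        rw [← h1, h.norm_pow] at hlt
        exact lt_of_mul_lt_mul_left hlt (by positivity)
      have h3 := h.eq_zero_of_mem_tile ht (Λ.neg_mem hz₁) (by rwa [sub_neg_eq_add, add_comm])
      rw [neg_eq_zero.1 h3, norm_zero, mul_zero]
      exact norm_nonneg _
    · have h1 : ρ ^ w * ‖z₁‖ ≤ ‖z‖ + ρ ^ w * R := by
        rw [← h.norm_pow, hzd]
        exact (norm_sub_le _ _).trans (by linarith [h.norm_digit_le hd])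
      have h2 : ρ ^ w * R ≤ ‖z‖ * (R / r) := by
        calc ρ ^ w * R = ρ ^ w * r * (R / r) := by field_simp
          _ ≤ _ := by gcongr
      calc min ρ (ρ ^ w / (1 + R / r)) * ‖z₁‖ ≤ ρ ^ w / (1 + R / r) * ‖z₁‖ := by
            gcongr
            exact min_le_right _ _
        _ ≤ ‖z‖ := by
          rw [div_mul_eq_mul_div, div_le_iff₀ h1R]
          linarith

/-- Every lattice point has a finite non-adjacent form, whose number of trailing zeros is
determined by the divisibility by the base. -/
lemma exists_node (h : DigitSystem Λ Φ ρ T r R w D) {z : E} (hz : z ∈ Λ) :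
    ∃ m k, Node Φ D w m z k ∧ ∀ t : ℕ, z ∈ (Φ ^ t) '' (Λ : Set E) → k ≤ w - 1 - t := by
  have hw := h.width_pos
  have hr := h.r_pos
  obtain ⟨c, hc, hquot⟩ := h.exists_quotient
  have hc0 : 0 < c := by linarith
  have key : ∀ N : ℕ, ∀ z ∈ Λ, ‖z‖ < c ^ N * r →
      ∃ m k, Node Φ D w m z k ∧ ∀ t : ℕ, z ∈ (Φ ^ t) '' (Λ : Set E) → k ≤ w - 1 - t := by
    intro N
    induction N with
    | zero =>
      intro z hz hlt
      rw [pow_zero, one_mul] at hlt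
      have h0 := h.eq_zero_of_mem_tile h.zero_mem_tile hz (by rwa [zero_sub, norm_neg])
      subst h0
      exact ⟨0, 0, Node.root, fun t _ => Nat.zero_le _⟩
    | succ N ih =>
      intro z hz hlt
      obtain ⟨z₁, hz₁, hle, hcase⟩ := hquot z hz
      obtain ⟨m, k, hnode, hk⟩ := ih z₁ hz₁ (by
        rw [pow_succ', mul_assoc] at hlt
        exact lt_of_mul_lt_mul_left (hle.trans_lt hlt) hc0.le)
      rcases hcase with rfl | ⟨hzΦ, d, hd, hd0, rfl⟩
      · refine ⟨m + 1, k - 1, hnode.zero, fun t ht => ?_⟩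
        rcases t with _ | t
        · have := hk 0 ⟨z₁, hz₁, rfl⟩
          omega
        · have := hk t (by
            obtain ⟨y, hy, hyz⟩ := ht
            refine ⟨y, hy, Φ.injective ?_⟩
            rw [← hyz, pow_succ']
            rfl)
          omega
      · have hk0 := hk 0 ⟨z₁, hz₁, rfl⟩
        -- The `w - 1` zeros exhaust whatever was still due after `z₁`.
        have h1 := hnode.zero_pow (w - 1)
        rw [show k - (w - 1) = 0 by omega] at h1
        have h2 := h1.digit hd hd0
        have h3 : Φ ((Φ ^ (w - 1)) z₁) = (Φ ^ w) z₁ := by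
          conv_rhs => rw [show w = 1 + (w - 1) by omega, pow_add, pow_one]
          rfl
        rw [h3] at h2
        refine ⟨_, _, h2, fun t ht => ?_⟩
        rcases t with _ | t
        · omega
        · refine absurd ?_ hzΦ
          obtain ⟨y, hy, hyz⟩ := ht
          refine ⟨(Φ ^ t) y, h.pow_mem t hy, ?_⟩
          rw [← hyz, pow_succ']
          rfl
  obtain ⟨N, hN⟩ := pow_unbounded_of_one_lt (‖z‖ / r) hc
  exact key N z hz (by rwa [div_lt_iff₀ hr] at hN)

section Measure

variable [MeasurableSpace E] [BorelSpace E] [FiniteDimensional ℝ E] {vol : Measure E}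
  [vol.IsAddHaarMeasure] {q : ℝ}

lemma isCompact_cell (h : DigitSystem Λ Φ ρ T r R w D) (z : E) (k : ℕ) :
    IsCompact (cell Φ D w z k) :=
  (isCompact_valueSet h.one_lt h.norm_map h.finite (b := -(k : ℤ)) subset_rfl).vadd z

lemma measureReal_cell (hq : 0 < q)
    (hvol : ∀ s, vol (Φ '' s) = ENNReal.ofReal q * vol s) (z : E) (k : ℕ) :
    vol.real (cell Φ D w z k) = vol.real (valueSet Φ D w (Iio 0)) / q ^ k := by
  rw [cell, measureReal_vadd, ← image_zpow_valueSet Φ (k := -(k : ℤ)) (I := Iio 0),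
    measureReal_image_zpow hq hvol, zpow_neg, zpow_natCast]
  · ring
  · intro i; simp only [mem_Iio]; omega

open Classical in
-- The children cover ΦF, and their volumes sum to λ(F) (1 + q^(w-1) (q-1)/q^(w-1)) = q λ(F).
lemma aedisjoint_children (h : DigitSystem Λ Φ ρ T r R w D) (hq : 0 < q)
    (hvol : ∀ s, vol (Φ '' s) = ENNReal.ofReal q * vol s)
    (hcard : ((D \ {0}).ncard : ℝ) = q ^ (w - 1) * (q - 1)) {η η' : E} (hη : η ∈ D) (hη' : η' ∈ D)
    (hne : η ≠ η') : AEDisjoint vol (cell Φ D w η (if η = 0 then 0 else w - 1))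
      (cell Φ D w η' (if η' = 0 then 0 else w - 1)) := by
  refine aedisjoint_of_sum_le (μ := vol) (s := h.finite.toFinset)
    (f := fun η => cell Φ D w η (if η = 0 then 0 else w - 1))
    (fun η _ => (h.isCompact_cell _ _).measurableSet)
    (fun η _ => (h.isCompact_cell _ _).measure_ne_top) ?_
    (h.finite.mem_toFinset.2 hη) (h.finite.mem_toFinset.2 hη') hne
  have h0 : (0 : E) ∈ h.finite.toFinset := h.finite.mem_toFinset.2 h.digits.zero_mem
  have hunion : ⋃ η ∈ h.finite.toFinset, cell Φ D w η (if η = 0 then 0 else w - 1)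
      = Φ '' valueSet Φ D w (Iio 0) := by
    conv_rhs => enter [1]; rw [← zpow_one Φ]
    rw [image_zpow_valueSet Φ (k := 1) (J := Iio 1) (fun i => by simp only [mem_Iio]; omega),
      h.valueSet_Iio_one]
    ext x
    simp only [mem_iUnion, h.finite.mem_toFinset, mem_union, exists_prop, Set.mem_sdiff,
      mem_singleton_iff]
    constructor
    · rintro ⟨η, hη, hx⟩
      by_cases hη0 : η = 0
      · subst hη0; left; simpa using hx
      · right; exact ⟨η, ⟨hη, hη0⟩, by simpa [hη0] using hx⟩
    · rintro (hx | ⟨η, ⟨hη, hη0⟩, hx⟩)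
      · exact ⟨0, h.digits.zero_mem, by simpa using hx⟩
      · exact ⟨η, hη, by simpa [hη0] using hx⟩
  rw [hunion]
  have h1 : vol.real (Φ '' valueSet Φ D w (Iio 0)) = q * vol.real (valueSet Φ D w (Iio 0)) := by
    have := measureReal_image_zpow hq hvol 1 (valueSet Φ D w (Iio 0))
    rwa [zpow_one, zpow_one] at this
  rw [h1, ← Finset.add_sum_erase _ _ h0]
  have h2 : ∀ η ∈ h.finite.toFinset.erase 0,
      vol.real (cell Φ D w η (if η = 0 then 0 else w - 1))
        = vol.real (valueSet Φ D w (Iio 0)) / q ^ (w - 1) := fun η hη => by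
    rw [if_neg (Finset.ne_of_mem_erase hη), measureReal_cell hq hvol]
  rw [Finset.sum_congr rfl h2, if_pos rfl, measureReal_cell hq hvol, Finset.sum_const, nsmul_eq_mul]
  have h3 : ((h.finite.toFinset.erase 0).card : ℝ) = q ^ (w - 1) * (q - 1) := by
    rw [← hcard, ← ncard_coe_finset, Finset.coe_erase, h.finite.coe_toFinset]
  rw [h3, pow_zero, div_one]
  have : q ^ (w - 1) ≠ 0 := by positivity
  field_simp
  linarith

lemma aedisjoint_image (hvol : ∀ s, vol (Φ '' s) = ENNReal.ofReal q * vol s)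
    {s t : Set E} (hst : AEDisjoint vol s t) : AEDisjoint vol (Φ '' s) (Φ '' t) := by
  rw [AEDisjoint, ← image_inter Φ.injective, hvol, hst, mul_zero]

lemma aedisjoint_vadd (x : E) {s t : Set E} (hst : AEDisjoint vol s t) :
    AEDisjoint vol (x +ᵥ s) (x +ᵥ t) := by
  rw [AEDisjoint, ← vadd_set_inter, measure_vadd, hst]

/-- Each cell lies in the image of its parent's cell, so distinct parents are settled by induction
and siblings by `aedisjoint_children`. Nodes are pairs `(z, k)`, so uniqueness of expansions is not
presupposed. -/
lemma aedisjoint_cell (h : DigitSystem Λ Φ ρ T r R w D) (hq : 0 < q)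
    (hvol : ∀ s, vol (Φ '' s) = ENNReal.ofReal q * vol s)
    (hcard : ((D \ {0}).ncard : ℝ) = q ^ (w - 1) * (q - 1)) {m : ℕ} {z z' : E} {k k' : ℕ}
    (hz : Node Φ D w m z k) (hz' : Node Φ D w m z' k') (hne : z = z' → k ≠ k') :
    AEDisjoint vol (cell Φ D w z k) (cell Φ D w z' k') := by
  classical
  induction m generalizing z z' k k' with
  | zero =>
    cases hz
    cases hz'
    exact absurd rfl (hne rfl)
  | succ m ih =>
    have hvadd : ∀ (x y : E) (k : ℕ), cell Φ D w (x + y) k = x +ᵥ cell Φ D w y k := fun x y k => by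
      rw [cell, cell, vadd_vadd]
    have hparent : ∀ {x x' : E} {l l' : ℕ}, Node Φ D w m x l → Node Φ D w m x' l' →
        (x = x' → l ≠ l') → cell Φ D w z k ⊆ Φ '' cell Φ D w x l →
        cell Φ D w z' k' ⊆ Φ '' cell Φ D w x' l' →
        AEDisjoint vol (cell Φ D w z k) (cell Φ D w z' k') := fun hx hx' hne hs hs' =>
      (aedisjoint_image hvol (ih hx hx' hne)).mono hs hs'
    cases hz with
    | @zero _ x l hx =>
      cases hz' with
      | @zero _ x' l' hx' =>
        refine hparent hx hx' ?_ (cell_zero_subset _ _) (cell_zero_subset _ _)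
        rintro rfl rfl
        exact hne rfl rfl
      | @digit _ x' η' hx' hη' hη0' =>
        -- A non-zero digit is appended only when no zeros are due. For `l ≠ 0` the parents
        -- therefore differ as nodes, even if `x = x'`.
        by_cases hxx : x = x' ∧ l = 0
        · obtain ⟨rfl, rfl⟩ := hxx
          have := h.aedisjoint_children hq hvol hcard h.digits.zero_mem hη' hη0'.symm
          rw [if_pos rfl, if_neg hη0'] at this
          rw [hvadd, ← add_zero (Φ x), hvadd, add_zero]
          exact aedisjoint_vadd _ this
        · exact hparent hx hx' (fun h1 h2 => hxx ⟨h1, h2⟩) (cell_zero_subset _ _)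
            (h.cell_digit_subset _ hη' hη0')
    | @digit _ x η hx hη hη0 =>
      cases hz' with
      | @zero _ x' l' hx' =>
        by_cases hxx : x = x' ∧ l' = 0
        · obtain ⟨rfl, rfl⟩ := hxx
          have := h.aedisjoint_children hq hvol hcard hη h.digits.zero_mem hη0
          rw [if_pos rfl, if_neg hη0] at this
          rw [hvadd, ← add_zero (Φ x), hvadd, add_zero]
          exact aedisjoint_vadd _ this
        · exact hparent hx hx' (fun h1 h2 => hxx ⟨h1, h2.symm⟩) (h.cell_digit_subset _ hη hη0)
            (cell_zero_subset _ _)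
      | @digit _ x' η' hx' hη' hη0' =>
        by_cases hxx : x = x'
        · subst hxx
          have hηη : η ≠ η' := by
            rintro rfl
            exact hne rfl rfl
          have := h.aedisjoint_children hq hvol hcard hη hη' hηη
          rw [if_neg hη0, if_neg hη0'] at this
          rw [hvadd, hvadd]
          exact aedisjoint_vadd _ this
        · exact hparent hx hx' (fun h1 => absurd h1 hxx) (h.cell_digit_subset _ hη hη0)
            (h.cell_digit_subset _ hη' hη0')

end Measure

end DigitSystem

end WNAF

/-! ### Upper bound for the volume of the fundamental domain by packing. -/

namespace WNAF

variable {E : Type*} [NormedAddCommGroup E] [NormedSpace ℝ E]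
variable {Φ : E ≃L[ℝ] E} {ρ : ℝ} {D : Set E} {w : ℕ}

/-! ### Volume of the fundamental domain -/

/-- The weights with partial sums `∑ t ≤ a, divWeight q v t = q ^ a / q ^ v`. -/
def divWeight (q : ℝ) (v t : ℕ) : ℝ := if t = 0 then 1 / q ^ v else q ^ t / q ^ v * (1 - q⁻¹)

lemma divWeight_nonneg {q : ℝ} (hq : 1 < q) (v t : ℕ) : 0 ≤ divWeight q v t := by
  have h1 : 0 ≤ 1 - q⁻¹ := sub_nonneg.2 (inv_le_one_of_one_le₀ hq.le)
  have h2 : 0 < q := by linarith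
  unfold divWeight
  split_ifs <;> positivity

lemma sum_divWeight {q : ℝ} (hq : 1 < q) (v a : ℕ) :
    ∑ t ∈ Finset.range (a + 1), divWeight q v t = q ^ a / q ^ v := by
  have hq0 : q ≠ 0 := by positivity
  induction a with
  | zero => simp [divWeight]
  | succ a ih =>
    rw [Finset.sum_range_succ, ih, divWeight, if_neg (by omega), pow_succ]
    field_simp
    ring

lemma sum_divWeight_div {q : ℝ} (hq : 1 < q) (v : ℕ) :
    ∑ t ∈ Finset.range (v + 1), divWeight q v t / q ^ t
      = ((q - 1) * (v + 1 : ℕ) + 1) / q ^ (v + 1) := by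
  have hq0 : q ≠ 0 := by positivity
  have h1 : ∀ t ∈ Finset.range v, divWeight q v (t + 1) / q ^ (t + 1) = (1 - q⁻¹) / q ^ v := by
    intro t _
    rw [divWeight, if_neg (by omega)]
    field_simp
  rw [Finset.sum_range_succ', Finset.sum_congr rfl h1, Finset.sum_const, Finset.card_range,
    nsmul_eq_mul, divWeight, if_pos rfl, pow_succ]
  push_cast
  field_simp
  ring

namespace DigitSystem

variable {Λ : Submodule ℤ E} {T : Set E} {r R : ℝ}
variable [MeasurableSpace E] [BorelSpace E] [FiniteDimensional ℝ E] {vol : Measure E}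
  [vol.IsAddHaarMeasure] {q : ℝ}

lemma finite_lattice_ball (Λ : Submodule ℤ E) [DiscreteTopology Λ] (s : ℝ) :
    (Metric.closedBall (0 : E) s ∩ Λ).Finite := by
  have hclosed : IsClosed (Λ : Set E) := by
    have : DiscreteTopology Λ.toAddSubgroup := inferInstanceAs (DiscreteTopology Λ)
    exact AddSubgroup.isClosed_of_discrete (H := Λ.toAddSubgroup)
  exact Metric.finite_isBounded_inter_isClosed ⟨inferInstanceAs (DiscreteTopology Λ)⟩
    Metric.isBounded_closedBall hclosed

open Classical in
/-- A ball is covered by the tiles of the sublattice `Φ ^ t Λ` close to it. -/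
lemma measureReal_closedBall_le [DiscreteTopology Λ] (h : DigitSystem Λ Φ ρ T r R w D)
    (hT : IsTiling vol Λ T) (hq : 0 < q) (hvol : ∀ s, vol (Φ '' s) = ENNReal.ofReal q * vol s)
    (s : ℝ) {t : ℕ} (ht : t ≤ w) :
    vol.real (Metric.closedBall (0 : E) s) ≤
      {z ∈ (finite_lattice_ball Λ (s + ρ ^ w * R)).toFinset | z ∈ (Φ ^ t) '' (Λ : Set E)}.card
        * (q ^ t * vol.real T) := by
  have hρ0 := h.rho_pos
  have hR := h.R_pos
  set S := {z ∈ (finite_lattice_ball Λ (s + ρ ^ w * R)).toFinset | z ∈ (Φ ^ t) '' (Λ : Set E)}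
    with hS
  have hcover : Metric.closedBall (0 : E) s ⊆ ⋃ z ∈ S, (z +ᵥ (Φ ^ (t : ℤ)) '' T) := by
    intro x hx
    have h1 : (Φ ^ (-(t : ℤ))) x ∈ ⋃ z ∈ Λ, (z +ᵥ T) := h.iUnion_eq ▸ mem_univ _
    obtain ⟨z, hz, τ, hτ, hzτ⟩ := mem_iUnion₂.1 h1
    have hx2 : x = (Φ ^ (t : ℤ)) z + (Φ ^ (t : ℤ)) τ := by
      rw [← map_add, ← zpow_zpow_neg_apply Φ t x, ← hzτ]
      rfl
    refine mem_iUnion₂.2 ⟨(Φ ^ (t : ℤ)) z, ?_, (Φ ^ (t : ℤ)) τ, ⟨τ, hτ, rfl⟩, hx2.symm⟩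
    rw [hS, Finset.mem_filter, Finite.mem_toFinset, zpow_natCast]
    refine ⟨⟨?_, h.pow_mem t hz⟩, z, hz, rfl⟩
    rw [mem_closedBall_zero_iff] at hx ⊢
    rw [zpow_natCast] at hx2
    have h2 : (Φ ^ t) z = x - (Φ ^ t) τ := by rw [hx2, add_sub_cancel_right]
    have h3 : ‖(Φ ^ t) τ‖ ≤ ρ ^ w * R := by
      rw [h.norm_pow]
      have := h.norm_le_of_mem_tile hτ
      have : ρ ^ t ≤ ρ ^ w := pow_le_pow_right₀ h.one_lt.le ht
      gcongr
    rw [h2]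
    exact (norm_sub_le _ _).trans (add_le_add hx h3)
  have hcompact : ∀ z : E, IsCompact (z +ᵥ (Φ ^ (t : ℤ)) '' T) := fun z =>
    ((h.isCompact_tile hT).image (Φ ^ (t : ℤ)).continuous).vadd z
  refine (measureReal_mono hcover (S.isCompact_biUnion fun z _ => hcompact z).measure_ne_top).trans
    ((measureReal_biUnion_finset_le _ _).trans (le_of_eq ?_))
  simp only [measureReal_vadd, Finset.sum_const, nsmul_eq_mul]
  rw [measureReal_image_zpow hq hvol, zpow_natCast]

/-- The cells of the lattice points in a ball form a packing. -/
lemma sum_cells_le [DiscreteTopology Λ] (h : DigitSystem Λ Φ ρ T r R w D) (hq : 0 < q)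
    (hvol : ∀ s, vol (Φ '' s) = ENNReal.ofReal q * vol s)
    (hcard : ((D \ {0}).ncard : ℝ) = q ^ (w - 1) * (q - 1)) {c : ℝ}
    (hc : ∀ x ∈ valueSet Φ D w (Iio 0), ‖x‖ ≤ c) {s : ℝ} {m k : E → ℕ}
    (hnode : ∀ z ∈ Λ, Node Φ D w (m z) z (k z)) :
    ∑ z ∈ (finite_lattice_ball Λ s).toFinset, vol.real (valueSet Φ D w (Iio 0)) / q ^ k z
      ≤ vol.real (Metric.closedBall (0 : E) (s + c)) := by
  set S := (finite_lattice_ball Λ s).toFinset with hS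
  have hSΛ : ∀ z ∈ S, z ∈ Λ := fun z hz => ((finite_lattice_ball Λ s).mem_toFinset.1 hz).2
  have h1 : ∀ z ∈ S, Node Φ D w (S.sup m) z (k z) := fun z hz =>
    (hnode z (hSΛ z hz)).mono (Finset.le_sup hz)
  rw [← Finset.sum_congr rfl fun z _ => measureReal_cell hq hvol z (k z),
    ← measureReal_biUnion_finset₀ ?_ ?_ fun z _ => (h.isCompact_cell z _).measure_ne_top]
  · refine measureReal_mono (iUnion₂_subset fun z hz => ?_)
      (isCompact_closedBall _ _).measure_ne_top
    rintro _ ⟨y, hy, rfl⟩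
    have hz' := ((finite_lattice_ball Λ s).mem_toFinset.1 hz).1
    rw [mem_closedBall_zero_iff] at hz' ⊢
    refine (norm_add_le _ _).trans (add_le_add hz' (hc y (valueSet_mono (fun i hi => ?_) hy)))
    simp only [mem_Iio] at *; omega
  · intro z hz z' hz' hne
    exact h.aedisjoint_cell hq hvol hcard (h1 z hz) (h1 z' hz') fun h => absurd h hne
  · exact fun z _ => (h.isCompact_cell z _).measurableSet.nullMeasurableSet

/-- The weights convert the divisibility bound on `k z` into counts of points of Φ^t Λ, which have
density 1/(q^t λ(T)); then the radius tends to infinity. -/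
lemma measureReal_fundDomain_le [DiscreteTopology Λ] (h : DigitSystem Λ Φ ρ T r R w D)
    (hT : IsTiling vol Λ T) (hq : 1 < q) (hvol : ∀ s, vol (Φ '' s) = ENNReal.ofReal q * vol s)
    (hcard : ((D \ {0}).ncard : ℝ) = q ^ (w - 1) * (q - 1)) :
    vol.real (valueSet Φ D w (Iio 0)) * (((q - 1) * w + 1) / q ^ w) ≤ vol.real T := by
  classical
  have hw := h.width_pos
  have hq0 : 0 < q := by linarith
  have hR := h.R_pos
  have hρ0 := h.rho_pos
  obtain ⟨v, rfl⟩ : ∃ v, w = v + 1 := ⟨w - 1, by omega⟩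
  rw [Nat.add_sub_cancel] at hcard
  set f := vol.real (valueSet Φ D (v + 1) (Iio 0)) with hf
  have hf0 : 0 ≤ f := measureReal_nonneg
  obtain ⟨c, hc⟩ := (isCompact_valueSet (w := v + 1) h.one_lt h.norm_map h.finite (b := 0)
    (I := Iio 0) subset_rfl).isBounded.exists_norm_le
  have hc0 : 0 ≤ c := (norm_nonneg _).trans (hc 0 (zero_mem_valueSet h.digits.zero_mem _))
  choose! m k hnode hk using fun z (hz : z ∈ Λ) => h.exists_node hz
  have key : ∀ s : ℝ, 0 ≤ s → f * (((q - 1) * (v + 1 : ℕ) + 1) / q ^ (v + 1))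
      * vol.real (Metric.closedBall (0 : E) s)
        ≤ vol.real T * vol.real (Metric.closedBall (0 : E) (s + ρ ^ (v + 1) * R + c)) := by
    intro s hs
    set S := (finite_lattice_ball Λ (s + ρ ^ (v + 1) * R)).toFinset with hS
    have hSΛ : ∀ z ∈ S, z ∈ Λ := fun z hz => ((finite_lattice_ball Λ _).mem_toFinset.1 hz).2
    have h1 : ∀ z ∈ S, ∑ t ∈ Finset.range (v + 1),
        (if z ∈ (Φ ^ t) '' (Λ : Set E) then divWeight q v t else 0) ≤ 1 / q ^ k z := by
      intro z hz
      have hkv : k z ≤ v := by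
        have := hk z (hSΛ z hz) 0 ⟨z, hSΛ z hz, rfl⟩
        omega
      calc ∑ t ∈ Finset.range (v + 1),
          (if z ∈ (Φ ^ t) '' (Λ : Set E) then divWeight q v t else 0)
          = ∑ t ∈ {t ∈ Finset.range (v + 1) | z ∈ ⇑(Φ ^ t) '' (Λ : Set E)}, divWeight q v t := by
            rw [Finset.sum_filter]
        _ ≤ ∑ t ∈ Finset.range (v - k z + 1), divWeight q v t := by
          -- Divisibility by Φ^t gives k z ≤ v - t, so only t ≤ v - k z contribute; t ≤ v keeps the
          -- subtraction genuine.
          refine Finset.sum_le_sum_of_subset_of_nonneg (fun t ht => ?_)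
            fun t _ _ => divWeight_nonneg hq v t
          rw [Finset.mem_filter, Finset.mem_range] at ht
          have := hk z (hSΛ z hz) t ht.2
          rw [Finset.mem_range]
          omega
        _ = 1 / q ^ k z := by
          rw [sum_divWeight hq, div_eq_div_iff (by positivity) (by positivity), one_mul, ← pow_add,
            Nat.sub_add_cancel hkv]
    have h2 : ∑ t ∈ Finset.range (v + 1), divWeight q v t *
        ({z ∈ S | z ∈ (Φ ^ t) '' (Λ : Set E)}.card : ℝ) ≤ ∑ z ∈ S, 1 / q ^ k z := by
      refine le_trans (le_of_eq ?_) (Finset.sum_le_sum h1)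
      rw [Finset.sum_comm]
      refine Finset.sum_congr rfl fun t _ => ?_
      rw [← Finset.sum_filter, Finset.sum_const, nsmul_eq_mul, mul_comm]
    have h3 : (∑ t ∈ Finset.range (v + 1), divWeight q v t / q ^ t)
        * vol.real (Metric.closedBall (0 : E) s)
          ≤ vol.real T * ∑ t ∈ Finset.range (v + 1), divWeight q v t *
            ({z ∈ S | z ∈ (Φ ^ t) '' (Λ : Set E)}.card : ℝ) := by
      rw [Finset.sum_mul, Finset.mul_sum]
      refine Finset.sum_le_sum fun t ht => ?_
      have h4 := h.measureReal_closedBall_le hT hq0 hvol s (t := t)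
        (by rw [Finset.mem_range] at ht; omega)
      have h5 := divWeight_nonneg hq v t
      calc divWeight q v t / q ^ t * vol.real (Metric.closedBall (0 : E) s)
          ≤ divWeight q v t / q ^ t * ({z ∈ S | z ∈ (Φ ^ t) '' (Λ : Set E)}.card
            * (q ^ t * vol.real T)) := by gcongr
        _ = _ := by field_simp
    rw [sum_divWeight_div hq] at h3
    have h6 := h.sum_cells_le hq0 hvol hcard hc (s := s + ρ ^ (v + 1) * R) hnode
    have h7 : f * ∑ z ∈ S, 1 / q ^ k z
        ≤ vol.real (Metric.closedBall (0 : E) (s + ρ ^ (v + 1) * R + c)) := by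
      refine le_trans (le_of_eq ?_) h6
      rw [Finset.mul_sum]
      exact Finset.sum_congr rfl fun z _ => by rw [mul_one_div]
    have hT0 : 0 ≤ vol.real T := measureReal_nonneg
    calc f * (((q - 1) * (v + 1 : ℕ) + 1) / q ^ (v + 1)) * vol.real (Metric.closedBall (0 : E) s)
        ≤ f * (vol.real T * ∑ z ∈ S, 1 / q ^ k z) := by
          rw [mul_assoc]
          refine mul_le_mul_of_nonneg_left (h3.trans ?_) hf0
          gcongr
      _ = vol.real T * (f * ∑ z ∈ S, 1 / q ^ k z) := by ring
      _ ≤ _ := by gcongr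
  have hb0 : 0 < vol.real (Metric.ball (0 : E) 1) :=
    ENNReal.toReal_pos (Metric.measure_ball_pos vol 0 one_pos).ne' measure_ball_lt_top.ne
  set n := Module.finrank ℝ E
  -- The radii of the two balls differ by a constant, so their volume ratio tends to 1.
  have hlim : Tendsto (fun s : ℝ => vol.real T * (1 + (ρ ^ (v + 1) * R + c) / s) ^ n) atTop
      (𝓝 (vol.real T * (1 + 0) ^ n)) :=
    ((tendsto_const_nhds.add (tendsto_const_nhds.div_atTop tendsto_id)).pow n).const_mul _
  rw [add_zero, one_pow, mul_one] at hlim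
  refine ge_of_tendsto hlim ?_
  filter_upwards [eventually_gt_atTop 0] with s hs
  have h1 := key s hs.le
  rw [Measure.addHaar_real_closedBall _ _ hs.le, Measure.addHaar_real_closedBall _ _ (by positivity),
    ← mul_assoc, ← mul_assoc] at h1
  have h2 := le_of_mul_le_mul_right h1 hb0
  rw [← le_div_iff₀ (by positivity), mul_div_assoc, ← div_pow] at h2
  refine h2.trans (le_of_eq ?_)
  congr 2
  field_simp
  ring

end DigitSystem

end WNAF

/-! ### Topology and measure of the characteristic sets. -/

namespace WNAF

variable {E : Type*} [NormedAddCommGroup E] [NormedSpace ℝ E]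
variable {Φ : E ≃L[ℝ] E} {ρ : ℝ} {D : Set E} {w : ℕ}

/-! ### Limits of sequences of sets -/

lemma liminf_eq_iUnion_of_monotone {α : Type*} {A : ℕ → Set α} (hA : Monotone A) :
    liminf A atTop = ⋃ j, A j := by
  ext x
  rw [mem_liminf_iff_eventually_mem, mem_iUnion, eventually_atTop]
  exact ⟨fun ⟨a, ha⟩ => ⟨a, ha a le_rfl⟩, fun ⟨a, ha⟩ => ⟨a, fun b hb => hA hb ha⟩⟩

lemma limsup_eq_iUnion_of_monotone {α : Type*} {A : ℕ → Set α} (hA : Monotone A) :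
    limsup A atTop = ⋃ j, A j := by
  ext x
  rw [mem_limsup_iff_frequently_mem, mem_iUnion, frequently_atTop]
  refine ⟨fun hx => (hx 0).imp fun j hj => hj.2, fun ⟨a, ha⟩ b => ?_⟩
  exact ⟨max a b, le_max_right _ _, hA (le_max_left _ _) ha⟩

lemma liminf_subset_limsup {α : Type*} (A : ℕ → Set α) : liminf A atTop ⊆ limsup A atTop :=
  fun _ hx => mem_limsup_iff_frequently_mem.2 (mem_liminf_iff_eventually_mem.1 hx).frequently

namespace DigitSystem

variable {Λ : Submodule ℤ E} {T : Set E} {r R : ℝ} {η : E}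

/-! ### Topology of the characteristic sets -/

section Topology

variable [CompleteSpace E]

lemma charSet_eq_vadd_fundDomain (h : DigitSystem Λ Φ ρ T r R w D) (hη : η ∈ D) (hη0 : η ≠ 0) :
    charSet Φ D w η
      = (Φ ^ (-(w : ℤ))) η +ᵥ (Φ ^ (-2 * (w : ℤ) + 1)) '' fundDomain Φ D w := by
  rw [h.charSet_eq hη hη0, fundDomain_eq_valueSet,
    image_zpow_valueSet Φ (J := Iio (-2 * (w : ℤ) + 1))]
  intro i; simp only [mem_Iio]; omega

lemma isCompact_charSet (h : DigitSystem Λ Φ ρ T r R w D) (hη : η ∈ D) (hη0 : η ≠ 0) :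
    IsCompact (charSet Φ D w η) := by
  rw [h.charSet_eq hη hη0]
  exact (isCompact_valueSet h.one_lt h.norm_map h.finite (b := -2 * (w : ℤ) + 1) subset_rfl).vadd _

lemma monotone_charSetLevel (h : DigitSystem Λ Φ ρ T r R w D) (hη : η ∈ D) (hη0 : η ≠ 0) :
    Monotone fun j => charSetLevel Φ D w η j := by
  intro j j' hj
  simp only [h.charSetLevel_eq_valueSet hη hη0]
  refine vadd_set_mono (valueSet_mono fun i hi => ?_)
  simp only [mem_Ico] at *; omega

lemma charSetLevel_subset (h : DigitSystem Λ Φ ρ T r R w D) (hη : η ∈ D) (hη0 : η ≠ 0) (j : ℕ) :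
    charSetLevel Φ D w η j ⊆ charSet Φ D w η := by
  rw [h.charSetLevel_eq_valueSet hη hη0, h.charSet_eq hη hη0]
  exact vadd_set_mono (valueSet_mono fun i hi => hi.2)

lemma charSet_eq_closure (h : DigitSystem Λ Φ ρ T r R w D) (hη : η ∈ D) (hη0 : η ≠ 0) :
    charSet Φ D w η = closure (⋃ j : ℕ, charSetLevel Φ D w η j) := by
  refine Subset.antisymm ?_ (closure_minimal (iUnion_subset fun j => h.charSetLevel_subset hη hη0 j)
    (h.isCompact_charSet hη hη0).isClosed)
  rw [h.charSet_eq hη hη0]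
  rintro _ ⟨y, hy, rfl⟩
  have h1 := valueSet_subset_closure h.one_lt h.norm_map h.finite h.digits.zero_mem subset_rfl hy
  have h2 := image_closure_subset_closure_image (continuous_const_vadd ((Φ ^ (-(w : ℤ))) η))
    (mem_image_of_mem _ h1)
  refine closure_mono ?_ h2
  rintro _ ⟨x, hx, rfl⟩
  obtain ⟨m, hm⟩ := mem_iUnion.1 hx
  refine mem_iUnion.2 ⟨m, ?_⟩
  rw [h.charSetLevel_eq_valueSet hη hη0]
  refine vadd_mem_vadd_set (valueSet_mono (fun i hi => ?_) hm)
  simp only [mem_inter_iff, mem_Iio, mem_Ici, mem_Ico] at *; omega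

/-- The lattice points of level `j` in the characteristic set are those of level `j` by
construction. -/
lemma mem_charSetLevel_of_mem_charSet (h : DigitSystem Λ Φ ρ T r R w D) (hη : η ∈ D) (hη0 : η ≠ 0)
    {j : ℕ} {z : E} (hz : z ∈ Λ) (hzη : (Φ ^ (-((j : ℤ) + w))) z ∈ charSet Φ D w η) :
    z ∈ (Φ ^ j) η +ᵥ intValues Φ D w (j + 1 - w) := by
  have hw := h.width_pos
  rw [h.charSet_eq hη hη0] at hzη
  obtain ⟨y, hy, hyz⟩ := hzη
  have h1 : z = (Φ ^ j) η + (Φ ^ ((j : ℤ) + w)) y := by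
    rw [← zpow_zpow_neg_apply Φ ((j : ℤ) + w) z, ← hyz]
    change (Φ ^ ((j : ℤ) + w)) ((Φ ^ (-(w : ℤ))) η + y) = _
    rw [map_add, ← zpow_add_apply, add_neg_cancel_right, zpow_natCast]
  have h2 : (Φ ^ ((j : ℤ) + w)) y ∈ valueSet Φ D w (Iio ((j + 1 - w : ℕ) : ℤ)) := by
    have h3 : (Φ ^ ((j : ℤ) + w)) y ∈ valueSet Φ D w (Iio ((j : ℤ) + 1 - w)) := by
      rw [← image_zpow_valueSet Φ (k := (j : ℤ) + w) (I := Iio (-2 * (w : ℤ) + 1))]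
      · exact mem_image_of_mem _ hy
      · intro i; simp only [mem_Iio]; omega
    -- For j + 1 < w the truncated bound is 0, which only enlarges the set of positions.
    refine valueSet_mono (fun i hi => ?_) h3
    simp only [mem_Iio] at *; omega
  have h3 : (Φ ^ ((j : ℤ) + w)) y ∈ Λ := by
    rw [show (Φ ^ ((j : ℤ) + w)) y = z - (Φ ^ j) η by rw [h1, add_sub_cancel_left]]
    exact Λ.sub_mem hz (h.pow_mem j (h.digits.subset hη))
  exact ⟨_, h.mem_intValues_of_mem_lattice _ h2 h3, h1.symm⟩

lemma tendsto_zpow_neg (h : DigitSystem Λ Φ ρ T r R w D) :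
    Tendsto (fun j : ℕ => ρ ^ (-((j : ℤ) + w)) * R) atTop (𝓝 0) := by
  have h1 : Tendsto (fun j : ℕ => ρ⁻¹ ^ j * ((ρ ^ w)⁻¹ * R)) atTop (𝓝 (0 * ((ρ ^ w)⁻¹ * R))) :=
    (tendsto_pow_atTop_nhds_zero_of_lt_one (inv_nonneg.2 h.rho_pos.le)
      (inv_lt_one_of_one_lt₀ h.one_lt)).mul_const _
  rw [zero_mul] at h1
  refine h1.congr fun j => ?_
  rw [zpow_neg, ← Nat.cast_add, zpow_natCast, pow_add, mul_inv, inv_pow, mul_assoc]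

lemma charSetLevel_subset_charApprox
    (h : DigitSystem Λ Φ ρ T r R w D) (hη : η ∈ D) (hη0 : η ≠ 0) (j : ℕ) :
    charSetLevel Φ D w η j ⊆ charApprox Λ T Φ D w η j := by
  rw [h.charSetLevel_eq hη hη0, h.charApprox_eq hη hη0]
  refine image_mono fun z hz => mem_iUnion₂.2 ⟨z, hz, ?_⟩
  exact mem_vadd_set.2 ⟨0, h.zero_mem_tile, by simp⟩

lemma exists_dist_le_of_mem_charApprox
    (h : DigitSystem Λ Φ ρ T r R w D) (hη : η ∈ D) (hη0 : η ≠ 0) {j : ℕ} {x : E}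
    (hx : x ∈ charApprox Λ T Φ D w η j) :
    ∃ y ∈ charSet Φ D w η, dist x y ≤ ρ ^ (-((j : ℤ) + w)) * R := by
  have hρ0 := h.rho_pos
  rw [h.charApprox_eq hη hη0] at hx
  obtain ⟨x, hx, rfl⟩ := hx
  obtain ⟨z, hz, t, ht, rfl⟩ := mem_iUnion₂.1 hx
  refine ⟨(Φ ^ (-((j : ℤ) + w))) z, h.charSetLevel_subset hη hη0 j ?_, ?_⟩
  · rw [h.charSetLevel_eq hη hη0]
    exact mem_image_of_mem _ hz
  · rw [dist_eq_norm, ← map_sub, h.norm_zpow]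
    have : ‖z + t - z‖ ≤ R := by
      rw [add_sub_cancel_left]
      exact h.norm_le_of_mem_tile ht
    exact mul_le_mul_of_nonneg_left this (by positivity)

lemma limsup_charApprox_subset
    (h : DigitSystem Λ Φ ρ T r R w D) (hη : η ∈ D) (hη0 : η ≠ 0) :
    limsup (fun j : ℕ => charApprox Λ T Φ D w η j) atTop ⊆ charSet Φ D w η := by
  intro x hx
  rw [← (h.isCompact_charSet hη hη0).isClosed.closure_eq, Metric.mem_closure_iff]
  intro ε hε
  obtain ⟨j, hj, hjε⟩ := ((mem_limsup_iff_frequently_mem.1 hx).and_eventually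
    (h.tendsto_zpow_neg.eventually (gt_mem_nhds hε))).exists
  obtain ⟨y, hy, hxy⟩ := h.exists_dist_le_of_mem_charApprox hη hη0 hj
  exact ⟨y, hy, hxy.trans_lt hjε⟩

lemma iUnion_charSetLevel_subset_liminf
    (h : DigitSystem Λ Φ ρ T r R w D) (hη : η ∈ D) (hη0 : η ≠ 0) :
    ⋃ j : ℕ, charSetLevel Φ D w η j ⊆ liminf (fun j : ℕ => charApprox Λ T Φ D w η j) atTop := by
  refine iUnion_subset fun j x hx => mem_liminf_iff_eventually_mem.2 (eventually_atTop.2 ⟨j, fun i hi => ?_⟩)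
  exact h.charSetLevel_subset_charApprox hη hη0 i (h.monotone_charSetLevel hη hη0 hi hx)

lemma charSet_eq_closure_liminf
    (h : DigitSystem Λ Φ ρ T r R w D) (hη : η ∈ D) (hη0 : η ≠ 0) :
    charSet Φ D w η = closure (liminf (fun j : ℕ => charApprox Λ T Φ D w η j) atTop) := by
  refine Subset.antisymm ?_ (closure_minimal
    ((liminf_subset_limsup _).trans (h.limsup_charApprox_subset hη hη0))
    (h.isCompact_charSet hη hη0).isClosed)
  rw [h.charSet_eq_closure hη hη0]
  exact closure_mono (h.iUnion_charSetLevel_subset_liminf hη hη0)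

lemma charSet_eq_closure_limsup
    (h : DigitSystem Λ Φ ρ T r R w D) (hη : η ∈ D) (hη0 : η ≠ 0) :
    charSet Φ D w η = closure (limsup (fun j : ℕ => charApprox Λ T Φ D w η j) atTop) := by
  refine Subset.antisymm ?_ (closure_minimal (h.limsup_charApprox_subset hη hη0)
    (h.isCompact_charSet hη hη0).isClosed)
  rw [h.charSet_eq_closure_liminf hη hη0]
  exact closure_mono (liminf_subset_limsup _)

/-- The lattice point whose scaled tile contains `x` eventually falls, after scaling, into the ball
around `x` inside the characteristic set; by `mem_charSetLevel_of_mem_charSet` its tile belongs to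
the approximation. -/
lemma interior_charSet_subset_liminf
    (h : DigitSystem Λ Φ ρ T r R w D) (hη : η ∈ D) (hη0 : η ≠ 0) :
    interior (charSet Φ D w η) ⊆ liminf (fun j : ℕ => charApprox Λ T Φ D w η j) atTop := by
  have hρ0 := h.rho_pos
  intro x hx
  obtain ⟨ε, hε, hball⟩ := Metric.mem_nhds_iff.1 (mem_interior_iff_mem_nhds.1 hx)
  rw [mem_liminf_iff_eventually_mem]
  filter_upwards [h.tendsto_zpow_neg.eventually (gt_mem_nhds hε)] with j hj
  have h1 : (Φ ^ ((j : ℤ) + w)) x ∈ ⋃ z ∈ Λ, (z +ᵥ T) := h.iUnion_eq ▸ mem_univ _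
  obtain ⟨z, hz, t, ht, hzt⟩ := mem_iUnion₂.1 h1
  have h2 : (Φ ^ (-((j : ℤ) + w))) z ∈ charSet Φ D w η := by
    refine hball ?_
    rw [Metric.mem_ball, dist_eq_norm]
    refine lt_of_le_of_lt ?_ hj
    have h3 : (Φ ^ (-((j : ℤ) + w))) z - x = -(Φ ^ (-((j : ℤ) + w))) t := by
      nth_rw 1 [← zpow_neg_zpow_apply Φ ((j : ℤ) + w) x]
      rw [← hzt, ← map_sub, ← map_neg]
      congr 1
      change z - (z + t) = -t
      abel
    rw [h3, norm_neg, h.norm_zpow]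
    have := h.norm_le_of_mem_tile ht
    gcongr
  rw [h.charApprox_eq hη hη0]
  refine ⟨(Φ ^ ((j : ℤ) + w)) x, mem_iUnion₂.2
    ⟨z, h.mem_charSetLevel_of_mem_charSet hη hη0 hz h2, t, ht, hzt⟩, zpow_neg_zpow_apply Φ _ x⟩

end Topology

/-! ### Volume of the characteristic sets -/

section Measure

variable [FiniteDimensional ℝ E] [MeasurableSpace E] [BorelSpace E] {vol : Measure E} [vol.IsAddHaarMeasure] {q : ℝ}

lemma exists_bound_measureReal_charApprox (h : DigitSystem Λ Φ ρ T r R w D)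
    (hT : IsTiling vol Λ T) (hq : 2 ≤ q) (hvol : ∀ s, vol (Φ '' s) = ENNReal.ofReal q * vol s)
    (hcard : ((D \ {0}).ncard : ℝ) = q ^ (w - 1) * (q - 1)) (hη : η ∈ D) (hη0 : η ≠ 0) :
    ∃ C : ℝ, ∀ j : ℕ, |vol.real (charApprox Λ T Φ D w η j)
        - vol.real T * (1 / (q ^ (w - 1) * ((q - 1) * w + 1)))|
      ≤ C * ((1 + 1 / (q * (w : ℝ) ^ 3))⁻¹) ^ j := by
  have hw := h.width_pos
  have hq0 : 0 < q := by linarith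
  obtain ⟨v, rfl⟩ : ∃ v, w = v + 1 := ⟨w - 1, by omega⟩
  obtain ⟨C, hC⟩ := exists_bound_of_counting_recurrence hq v
    (N := fun m => ((intValues Φ D (v + 1) m).ncard : ℝ))
    (by simp [h.intValues_zero]) (fun m => by
      simp only [h.ncard_intValues_succ m]
      push_cast
      rw [hcard, Nat.add_sub_cancel])
  have hT0 : 0 ≤ vol.real T := measureReal_nonneg
  have hden : 0 < (q - 1) * (v + 1 : ℕ) + 1 := by
    have : 0 ≤ (q - 1) * (v + 1 : ℕ) := mul_nonneg (by linarith) (Nat.cast_nonneg _)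
    linarith
  -- The factor converts N/q^(j+w) into the normalised count N q^v/q^j.
  refine ⟨vol.real T / q ^ (2 * v + 1) * C, fun j => ?_⟩
  rw [h.measureReal_charApprox hT hq0 hvol hη hη0, Nat.add_sub_cancel,
    show j + 1 - (v + 1) = j - v by omega]
  have h1 : ((intValues Φ D (v + 1) (j - v)).ncard : ℝ) / q ^ (j + (v + 1)) * vol.real T
      - vol.real T * (1 / (q ^ v * ((q - 1) * (v + 1 : ℕ) + 1)))
      = vol.real T / q ^ (2 * v + 1) * (((intValues Φ D (v + 1) (j - v)).ncard : ℝ) * q ^ v / q ^ j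
        - q ^ (v + 1) / ((q - 1) * (v + 1 : ℕ) + 1)) := by
    have e1 : q ^ (2 * v + 1) = q ^ v * q ^ v * q := by ring
    have e2 : q ^ (j + (v + 1)) = q ^ j * q ^ v * q := by ring
    rw [e1, e2, pow_succ]
    have := hden.ne'
    field_simp
  have h2 : 1 / (q * ((v + 1 : ℕ) : ℝ) ^ 3) = q⁻¹ / ((v + 1 : ℕ) : ℝ) ^ 3 := by
    rw [one_div, mul_inv, div_eq_mul_inv]
  rw [h1, abs_mul, abs_of_nonneg (by positivity), h2, mul_assoc]
  exact mul_le_mul_of_nonneg_left (hC j) (by positivity)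

lemma measureReal_charSet_le [DiscreteTopology Λ] (h : DigitSystem Λ Φ ρ T r R w D)
    (hT : IsTiling vol Λ T) (hq : 1 < q) (hvol : ∀ s, vol (Φ '' s) = ENNReal.ofReal q * vol s)
    (hcard : ((D \ {0}).ncard : ℝ) = q ^ (w - 1) * (q - 1)) (hη : η ∈ D) (hη0 : η ≠ 0) :
    vol.real (charSet Φ D w η) ≤ vol.real T * (1 / (q ^ (w - 1) * ((q - 1) * w + 1))) := by
  have hw := h.width_pos
  have hq0 : 0 < q := by linarith
  have h1 := h.measureReal_fundDomain_le hT hq hvol hcard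
  rw [h.charSet_eq_vadd_fundDomain hη hη0, measureReal_vadd, measureReal_image_zpow hq0 hvol,
    fundDomain_eq_valueSet]
  obtain ⟨v, rfl⟩ : ∃ v, w = v + 1 := ⟨w - 1, by omega⟩
  have hden : 0 < (q - 1) * (v + 1 : ℕ) + 1 := by
    have : 0 ≤ (q - 1) * (v + 1 : ℕ) := mul_nonneg (by linarith) (Nat.cast_nonneg _)
    linarith
  rw [show -2 * ((v + 1 : ℕ) : ℤ) + 1 = -((2 * v + 1 : ℕ) : ℤ) by push_cast; ring, zpow_neg,
    zpow_natCast, Nat.add_sub_cancel, mul_one_div, le_div_iff₀ (by positivity)]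
  refine le_trans (le_of_eq ?_) h1
  rw [show q ^ (2 * v + 1) = q ^ v * q ^ (v + 1) by ring]
  field_simp

/-- Closed thickenings of a compact set shrink to it in measure, and they contain the
approximations. -/
lemma le_measureReal_charSet (h : DigitSystem Λ Φ ρ T r R w D) (hη : η ∈ D) (hη0 : η ≠ 0) {c : ℝ}
    (hc : Tendsto (fun j => vol.real (charApprox Λ T Φ D w η j)) atTop (𝓝 c)) :
    c ≤ vol.real (charSet Φ D w η) := by
  have hK := h.isCompact_charSet hη hη0
  have h1 : Tendsto (fun δ => vol.real (Metric.cthickening δ (charSet Φ D w η))) (𝓝 0)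
      (𝓝 (vol.real (charSet Φ D w η))) :=
    (ENNReal.tendsto_toReal hK.measure_ne_top).comp (tendsto_measure_cthickening_of_isCompact hK)
  refine le_of_tendsto_of_tendsto' hc (h1.comp h.tendsto_zpow_neg) fun j => ?_
  refine measureReal_mono (fun x hx => ?_) hK.cthickening.measure_ne_top
  obtain ⟨y, hy, hxy⟩ := h.exists_dist_le_of_mem_charApprox hη hη0 hx
  exact Metric.mem_cthickening_of_dist_le _ _ _ _ hy hxy

end Measure

end DigitSystem

end WNAF

/-! ### Assembly of the main theorem. -/

namespace WNAF

variable {E : Type*} [NormedAddCommGroup E] [NormedSpace ℝ E]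

/-! ### The main theorem -/

lemma norm_map_eq {Φ : E ≃L[ℝ] E} {ρ : ℝ} (hρ : 1 < ρ) (hΦ : ‖(Φ : E →L[ℝ] E)‖ = ρ)
    (hΦinv : ‖(Φ.symm : E →L[ℝ] E)‖ = ρ⁻¹) (x : E) : ‖Φ x‖ = ρ * ‖x‖ := by
  have hρ0 : 0 < ρ := by linarith
  refine le_antisymm (hΦ ▸ (Φ : E →L[ℝ] E).le_opNorm x) ?_
  have h1 := (Φ.symm : E →L[ℝ] E).le_opNorm (Φ x)
  rw [hΦinv, ContinuousLinearEquiv.coe_coe, Φ.symm_apply_apply] at h1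
  rwa [inv_mul_eq_div, le_div_iff₀ hρ0, mul_comm] at h1

lemma decayConst_lt_one {ρ : ℝ} (hρ : 1 < ρ) (n : ℕ) {w : ℕ} (hw : 0 < w) :
    decayConst ρ n w < 1 := by
  have : (0 : ℝ) < w := by exact_mod_cast hw
  refine inv_lt_one_of_one_lt₀ ?_
  have : 0 < 1 / (ρ ^ n * (w : ℝ) ^ 3) := by positivity
  linarith

lemma integrableOn_indicator_sub {α : Type*} [MeasurableSpace α] {μ : Measure α} {T A B : Set α}
    (hTfin : μ T ≠ ∞) (hA : NullMeasurableSet A μ) (hB : NullMeasurableSet B μ) (hAT : A ⊆ T)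
    (hBT : B ⊆ T) :
    IntegrableOn (fun x => indicator A (fun _ => (1 : ℝ)) x - indicator B (fun _ => (1 : ℝ)) x) T μ ∧
      ∫ x in T, (indicator A (fun _ => (1 : ℝ)) x - indicator B (fun _ => (1 : ℝ)) x) ∂μ
        = μ.real A - μ.real B := by
  have hone : Integrable (fun _ : α => (1 : ℝ)) (μ.restrict T) := integrableOn_const hTfin
  have hac := Measure.restrict_le_self (μ := μ) (s := T) |>.absolutelyContinuous
  have hintT : ∀ {C : Set α}, NullMeasurableSet C μ →
      Integrable (indicator C fun _ => (1 : ℝ)) (μ.restrict T) := fun hC =>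
    hone.indicator₀ (hC.mono_ac hac)
  have hval : ∀ {C : Set α}, NullMeasurableSet C μ → C ⊆ T →
      ∫ x in T, indicator C (fun _ => (1 : ℝ)) x ∂μ = μ.real C := fun {C} hC hCT => by
    rw [integral_indicator₀ (hC.mono_ac hac), Measure.restrict_restrict₀ (hC.mono_ac hac),
      inter_eq_left.2 hCT, setIntegral_const, smul_eq_mul, mul_one]
  refine ⟨(hintT hA).sub (hintT hB), ?_⟩
  rw [integral_sub (hintT hA) (hintT hB), hval hA hAT, hval hB hBT]

end WNAF

end

/-- The space `E` is `ℝⁿ` with the chosen vector norm, `n` its dimension, and `vol` is Lebesgue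
measure (in coordinate-free form: a Haar measure). -/
theorem mainTheorem5
    {E : Type*} [NormedAddCommGroup E] [NormedSpace ℝ E] [FiniteDimensional ℝ E]
    [MeasurableSpace E] [BorelSpace E] (vol : Measure E) [vol.IsAddHaarMeasure]
    (n : ℕ) (hn : 0 < n) (hdim : Module.finrank ℝ E = n)
    -- the lattice
    (Λ : Submodule ℤ E) [DiscreteTopology Λ] [IsZLattice ℝ Λ]
    -- the base
    (Φ : E ≃L[ℝ] E) (hΦΛ : ∀ z ∈ Λ, Φ z ∈ Λ)
    (ρ : ℝ) (hρ : 1 < ρ)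
    (hΦeig : ∀ z ∈ (LinearMap.charpoly (Φ : E →ₗ[ℝ] E)).aroots ℂ, ‖z‖ = ρ)
    (hρn : ∃ q : ℕ, ρ ^ n = q)
    (hΦnorm : ‖(Φ : E →L[ℝ] E)‖ = ρ) (hΦinv : ‖(Φ.symm : E →L[ℝ] E)‖ = ρ⁻¹)
    -- the tiling
    (T : Set E) (hT : WNAF.IsTiling vol Λ T)
    (r R : ℝ) (hr : 0 < r) (hR : 0 < R)
    (hrT : Metric.closedBall 0 r ⊆ T) (hTR : T ⊆ Metric.closedBall 0 R)
    (T' : Set E) (hT'T : T' ⊆ T) (hT' : WNAF.IsExactTiling Λ T')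
    -- the width and the digits
    (w : ℕ) (hw : 0 < w) (hrR : R / r < ρ ^ w - 1)
    (D : Set E) (hD : WNAF.IsReducedResidueDigitSet Λ Φ w D) (hDT : D ⊆ (Φ ^ w) '' T)
    (hDcard : (D.ncard : ℝ) = ρ ^ (n * (w - 1)) * (ρ ^ n - 1) + 1)
    (η : E) (hη : η ∈ D) (hη0 : η ≠ 0) :
    -- description by the fundamental domain
    WNAF.charSet Φ D w η
        = (Φ ^ (-(w : ℤ))) η +ᵥ (Φ ^ (-2 * (w : ℤ) + 1)) '' WNAF.fundDomain Φ D w ∧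
    -- compactness
    IsCompact (WNAF.charSet Φ D w η) ∧
    -- closure of the union and of the limit of the finite-level sets
    (WNAF.charSet Φ D w η = closure (⋃ j : ℕ, WNAF.charSetLevel Φ D w η j) ∧
      liminf (fun j : ℕ => WNAF.charSetLevel Φ D w η j) atTop
        = limsup (fun j : ℕ => WNAF.charSetLevel Φ D w η j) atTop ∧
      WNAF.charSet Φ D w η
        = closure (limsup (fun j : ℕ => WNAF.charSetLevel Φ D w η j) atTop)) ∧
    -- limit of the approximations
    (WNAF.charSet Φ D w η
        = closure (liminf (fun j : ℕ => WNAF.charApprox Λ T Φ D w η j) atTop) ∧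
      WNAF.charSet Φ D w η
        = closure (limsup (fun j : ℕ => WNAF.charApprox Λ T Φ D w η j) atTop)) ∧
    -- interior points
    interior (WNAF.charSet Φ D w η)
        ⊆ liminf (fun j : ℕ => WNAF.charApprox Λ T Φ D w η j) atTop ∧
    -- inclusion in the tile
    ((fun x => x - (Φ ^ (-(w : ℤ))) η) '' WNAF.charSet Φ D w η ⊆ T ∧
      ∀ j : ℕ, (fun x => x - (Φ ^ (-(w : ℤ))) η) '' WNAF.charApprox Λ T Φ D w η j ⊆ T) ∧
    -- measure of the fractional parts
    (NullMeasurableSet (WNAF.fracPart hT' '' WNAF.charSet Φ D w η) vol ∧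
      vol (WNAF.charSet Φ D w η) = vol (WNAF.fracPart hT' '' WNAF.charSet Φ D w η) ∧
      ∀ j : ℕ,
        NullMeasurableSet (WNAF.fracPart hT' '' WNAF.charApprox Λ T Φ D w η j) vol ∧
        vol (WNAF.charApprox Λ T Φ D w η j)
          = vol (WNAF.fracPart hT' '' WNAF.charApprox Λ T Φ D w η j)) ∧
    -- measure of the approximations
    (WNAF.decayConst ρ n w < 1 ∧
      ∃ C : ℝ, ∀ j : ℕ,
        |vol.real (WNAF.charApprox Λ T Φ D w η j) - vol.real T * WNAF.expectConst ρ n w|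
          ≤ C * WNAF.decayConst ρ n w ^ j) ∧
    -- measure of the characteristic set
    vol (WNAF.fracPart hT' '' WNAF.charSet Φ D w η)
        = vol T * ENNReal.ofReal (WNAF.expectConst ρ n w) ∧
    -- the differences `beta`
    ((∀ j : ℕ,
        IntegrableOn (fun x =>
          indicator (WNAF.fracPart hT' '' WNAF.charApprox Λ T Φ D w η j) (fun _ => (1 : ℝ)) x
          - indicator (WNAF.fracPart hT' '' WNAF.charSet Φ D w η) (fun _ => (1 : ℝ)) x) T vol ∧
        WNAF.beta vol Λ T Φ D w η j
          = ∫ x in T,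
            (indicator (WNAF.fracPart hT' '' WNAF.charApprox Λ T Φ D w η j)
                (fun _ => (1 : ℝ)) x
              - indicator (WNAF.fracPart hT' '' WNAF.charSet Φ D w η)
                (fun _ => (1 : ℝ)) x) ∂vol) ∧
      ∃ C : ℝ, ∀ j : ℕ, |WNAF.beta vol Λ T Φ D w η j| ≤ C * WNAF.decayConst ρ n w ^ j) := by
  classical
  have hq1 : 1 < ρ ^ n := one_lt_pow₀ hρ hn.ne'
  -- Integrality of ρ^n enters here: the root estimate needs p = 1/q ≤ 1/2.
  have hq2 : 2 ≤ ρ ^ n := by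
    obtain ⟨q, hq⟩ := hρn
    rw [hq] at hq1 ⊢
    exact_mod_cast hq1
  have hq0 : 0 < ρ ^ n := by linarith
  -- An infinite set has `ncard` 0, so the positive digit count implies finiteness.
  have hDfin : D.Finite := by
    refine Set.finite_of_ncard_pos ?_
    have : (0 : ℝ) < D.ncard := by
      rw [hDcard]
      have : 0 ≤ ρ ^ (n * (w - 1)) * (ρ ^ n - 1) := mul_nonneg (by positivity) (by linarith)
      linarith
    exact_mod_cast this
  have h : WNAF.DigitSystem Λ Φ ρ T r R w D :=
    { one_lt := hρ
      width_pos := hw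
      norm_map := WNAF.norm_map_eq hρ hΦnorm hΦinv
      map_mem := hΦΛ
      digits := hD
      finite := hDfin
      r_pos := hr
      R_pos := hR
      closedBall_subset := hrT
      subset_closedBall := hTR
      ratio_lt := hrR
      digit_mem := hDT
      iUnion_eq := hT.iUnion_eq
      inter_subset := hT.inter_subset }
  have hvol : ∀ s, vol (Φ '' s) = ENNReal.ofReal (ρ ^ n) * vol s := fun s => by
    rw [Measure.addHaar_image_continuousLinearEquiv, ← hdim]
    congr 2
    exact WNAF.abs_det_eq_pow (Φ : E →ₗ[ℝ] E) hΦeig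
  have hcard : ((D \ {0}).ncard : ℝ) = (ρ ^ n) ^ (w - 1) * (ρ ^ n - 1) := by
    have h1 := ncard_sdiff_singleton_add_one hD.zero_mem hDfin
    have h2 : ((D \ {0}).ncard : ℝ) + 1 = D.ncard := by exact_mod_cast h1
    rw [hDcard] at h2
    rw [← pow_mul]
    linarith
  have hEc : WNAF.expectConst ρ n w = 1 / ((ρ ^ n) ^ (w - 1) * ((ρ ^ n - 1) * w + 1)) := by
    rw [WNAF.expectConst, pow_mul]
  have hμ1 := WNAF.decayConst_lt_one hρ n hw
  have hμ0 : 0 ≤ WNAF.decayConst ρ n w := by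
    unfold WNAF.decayConst
    positivity
  have happrox : ∃ C : ℝ, ∀ j : ℕ,
      |vol.real (WNAF.charApprox Λ T Φ D w η j) - vol.real T * WNAF.expectConst ρ n w|
        ≤ C * WNAF.decayConst ρ n w ^ j := by
    rw [hEc]
    exact h.exists_bound_measureReal_charApprox hT hq2 hvol hcard hη hη0
  have hcompact := h.isCompact_charSet hη hη0
  have hTfin : vol T ≠ ∞ := (h.isCompact_tile hT).measure_ne_top
  have hreal : vol.real (WNAF.charSet Φ D w η) = vol.real T * WNAF.expectConst ρ n w := by
    refine le_antisymm (hEc ▸ h.measureReal_charSet_le hT hq1 hvol hcard hη hη0)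
      (h.le_measureReal_charSet hη hη0 ?_)
    obtain ⟨C, hC⟩ := happrox
    rw [tendsto_iff_dist_tendsto_zero]
    refine squeeze_zero (fun _ => dist_nonneg) hC ?_
    simpa using (tendsto_pow_atTop_nhds_zero_of_lt_one hμ0 hμ1).const_mul C
  have hfracSet := h.measure_image_fracPart hT hT'T hT' hcompact.measurableSet
    (c := (Φ ^ (-(w : ℤ))) η) fun x hx => (h.norm_charSet_sub_le hη hη0 hx).trans_lt h.radius_lt
  have hfracApprox := fun j => h.measure_image_fracPart hT hT'T hT'
    (h.isClosed_charApprox hT hη hη0 j).measurableSet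
    (c := (Φ ^ (-(w : ℤ))) η) fun x hx => (h.norm_charApprox_sub_le hη hη0 hx).trans_lt h.radius_lt
  have hmono := h.monotone_charSetLevel hη hη0
  refine ⟨h.charSet_eq_vadd_fundDomain hη hη0, hcompact, ⟨h.charSet_eq_closure hη hη0, ?_, ?_⟩,
    ⟨h.charSet_eq_closure_liminf hη hη0, h.charSet_eq_closure_limsup hη hη0⟩,
    h.interior_charSet_subset_liminf hη hη0, ⟨?_, fun j => ?_⟩,
    ⟨hfracSet.1, hfracSet.2, hfracApprox⟩, ⟨hμ1, happrox⟩, ?_, fun j => ?_, ?_⟩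
  · rw [WNAF.liminf_eq_iUnion_of_monotone hmono, WNAF.limsup_eq_iUnion_of_monotone hmono]
  · rw [WNAF.limsup_eq_iUnion_of_monotone hmono]
    exact h.charSet_eq_closure hη hη0
  · rintro _ ⟨x, hx, rfl⟩
    exact interior_subset
      (h.mem_interior_tile ((h.norm_charSet_sub_le hη hη0 hx).trans_lt h.radius_lt))
  · rintro _ ⟨x, hx, rfl⟩
    exact interior_subset
      (h.mem_interior_tile ((h.norm_charApprox_sub_le hη hη0 hx).trans_lt h.radius_lt))
  · rw [← hfracSet.2, ← ofReal_measureReal hcompact.measure_ne_top, hreal,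
      ENNReal.ofReal_mul measureReal_nonneg, ofReal_measureReal hTfin]
  · have hintT := WNAF.integrableOn_indicator_sub hTfin (hfracApprox j).1 hfracSet.1
      ((WNAF.image_fracPart_subset hT' _).trans hT'T)
      ((WNAF.image_fracPart_subset hT' _).trans hT'T)
    refine ⟨hintT.1, ?_⟩
    rw [hintT.2, WNAF.beta, measureReal_def, measureReal_def, (hfracApprox j).2, hfracSet.2,
      measureReal_def, measureReal_def]
  · simp only [WNAF.beta, hreal]
    exact happrox
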